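/- **Model.** Let $X\in\mathbb R^{n\times p}$ be a fixed design with $\frac1n\sum_i x_{ij}^2=1$ for every $j$ and $|x_{ij}|\le X_{\max}$; let $\beta^*\in\mathbb R^p$ have support $S$, $s=|S|$, and let $y=X\beta^*+w$, where $w_1,\dots,w_n$ are i.i.d., mean zero and sub-Gaussian with parameter $\sigma^2>0$, i.e. $P(|w_i|>t)\le 2e^{-t^2/(2\sigma^2)}$ for all $t>0$. One observes $y$ and $Z=X\odot M$, where $M$ is independent of $w$ and its rows are i.i.d. with known mean $\mu_M$ and known covariance $\Sigma_M$, and are sub-Gaussian with parameter $\tau^2>0$, i.e. $P(|v'(m_i-\mu_M)|>t)\le 2e^{-t^2/(2\tau^2)}$ for all $t>0$, $\|v\|_2=1$. The entries of $\Sigma_M+\mu_M\mu_M'$ are at least $M_{\min}>0$, and those of $\mu_M$ lie in $[\mu_{\min},\mu_{\max}]$ with $\mu_{\min}>0$. Write $\theta=(\tau,\sigma,X_{\max},M_{\min},\mu_{\min},\mu_{\max})$. **Estimator.** Put $\Sigma=\frac1nX'X$, $\rho=\frac1nX'y$, $\widehat\Sigma=\frac1nZ'Z\oslash(\Sigma_M+\mu_M\mu_M')$,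 $\tilde\rho=\frac1nZ'y\oslash\mu_M$ ($\oslash$ is entrywise division). Let $\widetilde\Sigma$ be any positive semidefinite matrix nearest to $\widehat\Sigma$ in the norm $\|K\|_{\max}=\max_{i,j}|K_{ij}|$. For $\lambda>0$ a CoCoLasso estimate $\hat\beta$ is a minimizer of $\frac12\beta'\widetilde\Sigma\beta-\tilde\rho'\beta+\lambda\|\beta\|_1$. **Notation.** $\|K\|_\infty$ is the maximal absolute row sum of a matrix, $B=\|\beta^*_S\|_\infty$, $|\beta^*_{\min}|=\min_{j\in S}|\beta^*_j|$, $$\Omega=\min_{x\ne0,\ \|x_{S^c}\|_1\le3\|x_S\|_1}\frac{x'\Sigma x}{\|x\|_2^2},\qquad C_{\min}=\Lambda_{\min}(\Sigma_{S,S}),\qquad \gamma=1-\|\Sigma_{S^c,S}\Sigma_{S,S}^{-1}\|_\infty,\qquad \kappa=4\|\Sigma_{S,S}^{-1}\|_\infty+C_{\min}^{-1/2}.$$ "With probability at least $1-\delta$" means that the complementary event has outer probability at most $\delta$; the events below are required for every choice of $\widetilde\Sigma$. **Theorem.** There are universal constants $C,c>0$, positive functions $\zeta,\epsilon_0$ of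 $(\theta,B)$, and positive real-valued functions $\epsilon_1,\epsilon_2,\epsilon_3$ of $\theta$, $B$, $\|\Sigma_{S,S}^{-1}\|_\infty$, $\|\Sigma_{S,S}\|_\infty$, $C_{\min}$ and $\gamma$, such that the following holds for every instance of the model. 0. (Closeness.) For $0<\epsilon\le\epsilon_0$ and all $j,k$: $P(|\widehat\Sigma_{jk}-\Sigma_{jk}|\ge\epsilon)\le Ce^{-cn\epsilon^2/\zeta}$ and $P(|\tilde\rho_j-\rho_j|\ge\epsilon)\le Ce^{-cn\epsilon^2/(s^2\zeta)}$. 1. If $\Omega>0$, then for $0<\lambda\le\min(\epsilon_0,12\epsilon_0B)$ and $0<\epsilon\le\min(\epsilon_0,\Omega/(64s))$, with probability at least $1-p^2Ce^{-cn\lambda^2/(s^2\zeta)}-p^2Ce^{-cn\epsilon^2/\zeta}$ a CoCoLasso estimate exists and every CoCoLasso estimate satisfies $$\|\hat\beta-\beta^*\|_2\le C\lambda\sqrt s/\Omega,\qquad \|\hat\beta-\beta^*\|_1\le C\lambda s/\Omega.$$ 2. If $\gamma>0$ and $C_{\min}>0$, then for $0<\lambda\le\min(\epsilon_0,4\epsilon_0/\gamma)$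 and $0<\epsilon\le\min(\epsilon_1,\lambda/(\lambda\epsilon_2+\epsilon_3))$, with probability at least $1-p^2Ce^{-cn\gamma^2\lambda^2/(s^2\zeta)}-p^2Ce^{-cn\epsilon^2/(s^2\zeta)}$: (a) the CoCoLasso estimate $\hat\beta$ exists, is unique, and has support contained in $S$; (b) $\|\hat\beta_S-\beta^*_S\|_\infty\le\kappa\lambda$; (c) if $|\beta^*_{\min}|\ge\kappa\lambda$, then $\operatorname{sign}(\hat\beta_S)=\operatorname{sign}(\beta^*_S)$. 3. Consider a sequence of instances with the same $\theta$ and varying $n,p,S,X,\beta^*$ and error distributions, satisfying $\gamma>0$ and $C_{\min}>0$, with $\gamma$ bounded away from $0$ and $\kappa=O(1)$. If $n,p\to\infty$, $s^2\log p/n\to0$, and $|\beta^*_{\min}|\gg\lambda\gg s(\zeta\log p/n)^{1/2}$ with $\lambda>0$, then with probability tending to $1$ a CoCoLasso estimate exists and every CoCoLasso estimate satisfies $\operatorname{sign}(\hat\beta)=\operatorname{sign}(\beta^*)$; likewise, with probability tending to $1$ an estimate exists and every estimate satisfies $\|\hat\beta_S-\beta^*_S\|_\infty\le\kappa\lambda$.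 4. (Randomly missing data.) If the design and the noise are as above and $m_{ij}$ is the indicator that $x_{ij}$ is observed, where the $m_{ij}$ are independent of each other and of $w$, and $P(m_{ij}=1)=1-r_j$ with $r_j\le r_{\max}<1$, then (with $\mu_M=(1-r_j)_j$ and $\Sigma_M=\operatorname{diag}(r_j(1-r_j))$) this is an instance of the model with $\tau=\frac12$, $M_{\min}=(1-r_{\max})^2$, $\mu_{\min}=1-r_{\max}$, $\mu_{\max}=1$, so that 0–3 apply to it. -/

import Mathlib

open MeasureTheory ProbabilityTheory Filter Topology Asymptotics

namespace CoCoLasso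

noncomputable section

/-! ### Matrix norms, projection onto the positive semidefinite cone, Lasso objective -/

/-- Elementwise maximum norm `max_{i,j} |K i j|`. -/
def maxNorm {ι κ : Type*} (K : Matrix ι κ ℝ) : ℝ := ⨆ i, ⨆ j, |K i j|

/-- Matrix `ℓ_∞` norm: the maximal absolute row sum. -/
def infNorm {ι κ : Type*} [Fintype κ] (K : Matrix ι κ ℝ) : ℝ := ⨆ i, ∑ j, |K i j|

/-- Smallest eigenvalue of a real symmetric matrix. -/
def minEigenvalue {ι : Type*} [Fintype ι] [DecidableEq ι] (K : Matrix ι ι ℝ) : ℝ :=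
  sInf (spectrum ℝ K)

/-- `A` is a nearest positive semidefinite matrix `(K)_+` to `K` in the maximum norm
(such a matrix always exists, but need not be unique). -/
def IsNearestPSD {ι : Type*} (K A : Matrix ι ι ℝ) : Prop :=
  A.PosSemidef ∧ ∀ A' : Matrix ι ι ℝ, A'.PosSemidef → maxNorm (K - A) ≤ maxNorm (K - A')

theorem maxNorm_eq_norm {ι κ : Type*} [Fintype ι] [Fintype κ] (K : Matrix ι κ ℝ) :
    maxNorm K = ‖(fun i j => K i j : ι → κ → ℝ)‖ := by
  apply le_antisymm
  · refine Real.iSup_le (fun i => Real.iSup_le (fun j => ?_) (norm_nonneg _)) (norm_nonneg _)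
    exact (norm_le_pi_norm (fun j => K i j) j).trans
      (norm_le_pi_norm (fun i j => K i j : ι → κ → ℝ) i)
  · have h0 : 0 ≤ maxNorm K :=
      Real.iSup_nonneg fun i => Real.iSup_nonneg fun j => abs_nonneg _
    refine (pi_norm_le_iff_of_nonneg h0).2 fun i => (pi_norm_le_iff_of_nonneg h0).2 fun j => ?_
    exact (le_ciSup (f := fun j => |K i j|) (Set.finite_range _).bddAbove j).trans
      (le_ciSup (f := fun i => ⨆ j, |K i j|) (Set.finite_range _).bddAbove i)

/-- A nearest positive semidefinite matrix exists. -/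
theorem exists_isNearestPSD {ι : Type*} [Fintype ι] (K : Matrix ι ι ℝ) :
    ∃ A, IsNearestPSD K A := by
  let T : Set (ι → ι → ℝ) := {A | (Matrix.of A).PosSemidef}
  have hT : T = {A : ι → ι → ℝ | (∀ i j, A j i = A i j) ∧
      ∀ x : ι → ℝ, 0 ≤ ∑ i, x i * ∑ j, A i j * x j} := by
    ext A
    simp only [T, Set.mem_ofPred_eq, Matrix.posSemidef_iff_dotProduct_mulVec]
    simp [Matrix.IsHermitian, ← Matrix.ext_iff, dotProduct, Matrix.mulVec]
  have hc : IsClosed T := by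
    rw [hT, Set.ofPred_and]
    refine IsClosed.inter ?_ ?_
    · simp only [Set.ofPred_forall]
      refine isClosed_iInter fun i => isClosed_iInter fun j => isClosed_eq ?_ ?_ <;> fun_prop
    · simp only [Set.ofPred_forall]
      refine isClosed_iInter fun x => isClosed_le ?_ ?_ <;> fun_prop
  have hne : T.Nonempty := ⟨0, by
    show (Matrix.of (0 : ι → ι → ℝ)).PosSemidef
    exact Matrix.PosSemidef.zero⟩
  obtain ⟨A, hA, hd⟩ := hc.exists_infDist_eq_dist hne (fun i j => K i j)
  refine ⟨Matrix.of A, hA, fun A' hA' => ?_⟩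
  rw [maxNorm_eq_norm, maxNorm_eq_norm]
  have h := Metric.infDist_le_dist_of_mem (x := (fun i j => K i j : ι → ι → ℝ))
    (show (fun i j => A' i j) ∈ T from hA')
  rw [hd, dist_eq_norm, dist_eq_norm] at h
  exact h

/-- The objective `(1/2) b' A b - r' b + lam ‖b‖₁`. -/
def lassoObjective {ι : Type*} [Fintype ι] (A : Matrix ι ι ℝ) (r : ι → ℝ) (lam : ℝ)
    (b : ι → ℝ) : ℝ :=
  1 / 2 * (b ⬝ᵥ A.mulVec b) - r ⬝ᵥ b + lam * ∑ j, |b j|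

/-- `b` is a global minimizer of the objective. -/
def IsLassoMin {ι : Type*} [Fintype ι] (A : Matrix ι ι ℝ) (r : ι → ℝ) (lam : ℝ)
    (b : ι → ℝ) : Prop :=
  ∀ b' : ι → ℝ, lassoObjective A r lam b ≤ lassoObjective A r lam b'

/-! ### Sub-Gaussian variables and vectors -/

/-- Tail condition `P(|Y| > t) ≤ 2 exp(-t² / (2 τ²))` for all `t > 0`. -/
def HasSubGaussianTail {Ω : Type*} [MeasurableSpace Ω] (P : Measure Ω) (Y : Ω → ℝ)
    (τ : ℝ) : Prop :=
  ∀ t : ℝ, 0 < t → P.real {ω | t < |Y ω|} ≤ 2 * Real.exp (-(t ^ 2 / (2 * τ ^ 2)))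

/-- A random vector `V` is sub-Gaussian with parameter `τ²`: every unit-norm combination of the
centered vector satisfies the tail condition. -/
def IsSubGaussianVector {Ω : Type*} [MeasurableSpace Ω] {ι : Type*} [Fintype ι] (P : Measure Ω)
    (V : Ω → ι → ℝ) (τ : ℝ) : Prop :=
  ∀ v : ι → ℝ, ∑ j, v j ^ 2 = 1 →
    HasSubGaussianTail P (fun ω => ∑ j, v j * (V ω j - ∫ ω', V ω' j ∂P)) τ

/-! ### The regression model with multiplicative error -/

/-- The raw data: fixed design `X`, coefficients `β`, noise `w`, rows `M i` of the multiplicative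
error matrix, and the (known) row mean `μM` and row covariance matrix `covM`. -/
structure MultData (n p : ℕ) (Ω : Type*) where
  X : Matrix (Fin n) (Fin p) ℝ
  β : Fin p → ℝ
  w : Fin n → Ω → ℝ
  M : Fin n → Ω → Fin p → ℝ
  μM : Fin p → ℝ
  covM : Matrix (Fin p) (Fin p) ℝ

/-- The constants describing the model: sub-Gaussian parameters `τ²`, `σ²` of the error rows and of
the noise, and the bounds on the design and on the moments of the error rows. -/
structure MultParams where
  τ : ℝ
  σ : ℝ
  Xmax : ℝ
  Mmin : ℝ
  μmin : ℝ
  μmax : ℝ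

namespace MultData

variable {n p : ℕ} {Ω : Type*} (D : MultData n p Ω)

/-- The true support `S` of the coefficient vector. -/
def S : Finset (Fin p) := Finset.univ.filter fun j => D.β j ≠ 0

/-- The sparsity `s`, as a real number. -/
def s : ℝ := (D.S.card : ℝ)

/-- `‖β_S‖_∞` (which is `‖β‖_∞`, since `β` vanishes off `S`; the norm of `Fin p → ℝ` is the sup
norm). -/
def B : ℝ := ‖D.β‖

/-- `|β_min| = min_{j ∈ S} |β j|`. -/
def betaMin : ℝ := ⨅ j : {j // j ∈ D.S}, |D.β j|

/-- The response `y = X β + w`. -/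
def y (ω : Ω) : Fin n → ℝ := fun i => D.X.mulVec D.β i + D.w i ω

/-- The observed design `Z = X ⊙ M`. -/
def Z (ω : Ω) : Matrix (Fin n) (Fin p) ℝ := Matrix.of fun i j => D.X i j * D.M i ω j

/-- `Σ = X'X / n`. -/
def Sig : Matrix (Fin p) (Fin p) ℝ := (n : ℝ)⁻¹ • (D.X.transpose * D.X)

/-- `ρ = X'y / n`. -/
def rho (ω : Ω) : Fin p → ℝ := (n : ℝ)⁻¹ • D.X.transpose.mulVec (D.y ω)

/-- The surrogate `(Z'Z / n) ⊘ (covM + μM μM')`. -/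
def SigHat (ω : Ω) : Matrix (Fin p) (Fin p) ℝ := Matrix.of fun j k =>
  ((n : ℝ)⁻¹ • ((D.Z ω).transpose * D.Z ω)) j k / (D.covM j k + D.μM j * D.μM k)

/-- The surrogate `(Z'y / n) ⊘ μM`. -/
def rhoTilde (ω : Ω) : Fin p → ℝ := fun j =>
  ((n : ℝ)⁻¹ • (D.Z ω).transpose.mulVec (D.y ω)) j / D.μM j

/-- The block `Σ_{S,S}`. -/
def SigSS : Matrix {j // j ∈ D.S} {j // j ∈ D.S} ℝ := D.Sig.submatrix (fun j => j.1) (fun j => j.1)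

/-- The block `Σ_{Sᶜ,S}`. -/
def SigScS : Matrix {j // j ∉ D.S} {j // j ∈ D.S} ℝ :=
  D.Sig.submatrix (fun j => j.1) (fun j => j.1)

/-- The restricted eigenvalue: minimum of `x'Σx / ‖x‖₂²` over nonzero `x` with
`‖x_{Sᶜ}‖₁ ≤ 3 ‖x_S‖₁`. -/
def restrictedEigenvalue : ℝ :=
  sInf {v : ℝ | ∃ x : Fin p → ℝ, x ≠ 0 ∧ ∑ j ∈ D.Sᶜ, |x j| ≤ 3 * ∑ j ∈ D.S, |x j| ∧
    v = (x ⬝ᵥ D.Sig.mulVec x) / ∑ j, x j ^ 2}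

/-- `C_min = Λ_min(Σ_{S,S})`. -/
def Cmin : ℝ := minEigenvalue D.SigSS

/-- The number `γ` with `‖Σ_{Sᶜ,S} Σ_{S,S}⁻¹‖_∞ = 1 - γ`. -/
def gam : ℝ := 1 - infNorm (D.SigScS * D.SigSS⁻¹)

/-- `κ = 4 ‖Σ_{S,S}⁻¹‖_∞ + C_min^{-1/2}`. -/
def kap : ℝ := 4 * infNorm D.SigSS⁻¹ + (Real.sqrt D.Cmin)⁻¹

/-- The irrepresentable and minimum eigenvalue conditions. -/
def Irrepresentable : Prop := 0 < D.gam ∧ 0 < D.Cmin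

variable [MeasurableSpace Ω]

/-- The fixed design (normalized columns, bounded entries) and the i.i.d. centered sub-Gaussian
noise. -/
structure IsRegression (P : Measure Ω) (σ Xmax : ℝ) : Prop where
  σ_pos : 0 < σ
  normalized : ∀ j, (n : ℝ)⁻¹ * ∑ i, D.X i j ^ 2 = 1
  bounded : ∀ i j, |D.X i j| ≤ Xmax
  w_measurable : ∀ i, Measurable (D.w i)
  w_indep : iIndepFun D.w P
  w_ident : ∀ i i', IdentDistrib (D.w i) (D.w i') P P
  w_mean : ∀ i, ∫ ω, D.w i ω ∂P = 0
  w_subGaussian : ∀ i, HasSubGaussianTail P (D.w i) σ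

/-- The multiplicative error model: regression model as above; the rows of the error matrix are
i.i.d. sub-Gaussian vectors with mean `μM` and covariance `covM`, independent of the noise; the entries
of `E(m m') = covM + μM μM'` and of `μM` are bounded away from zero, and those of `μM` are bounded
above. -/
structure IsMultModel (P : Measure Ω) (θ : MultParams) : Prop where
  regression : D.IsRegression P θ.σ θ.Xmax
  τ_pos : 0 < θ.τ
  Mmin_pos : 0 < θ.Mmin
  μmin_pos : 0 < θ.μmin
  M_measurable : ∀ i, Measurable (D.M i)
  M_indep : iIndepFun D.M P
  M_ident : ∀ i i', IdentDistrib (D.M i) (D.M i') P P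
  M_mean : ∀ i j, ∫ ω, D.M i ω j ∂P = D.μM j
  M_cov : ∀ i j k, cov[fun ω => D.M i ω j, fun ω => D.M i ω k; P] = D.covM j k
  M_subGaussian : ∀ i, IsSubGaussianVector P (D.M i) θ.τ
  M_indep_w : IndepFun (fun ω i => D.M i ω) (fun ω i => D.w i ω) P
  Mmin_le : ∀ j k, θ.Mmin ≤ D.covM j k + D.μM j * D.μM k
  μmin_le : ∀ j, θ.μmin ≤ D.μM j
  le_μmax : ∀ j, D.μM j ≤ θ.μmax

/-- Randomly missing covariates: `M i j` is the indicator that `X i j` is observed; the indicators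
are independent of each other and of the noise, column `j` being missing with probability `r j`. -/
structure IsMissingData (P : Measure Ω) (r : Fin p → ℝ) : Prop where
  M_measurable : ∀ i, Measurable (D.M i)
  indicator : ∀ i ω j, D.M i ω j = 0 ∨ D.M i ω j = 1
  prob : ∀ i j, P.real {ω | D.M i ω j = 1} = 1 - r j
  M_indep : iIndepFun (fun (ij : Fin n × Fin p) ω => D.M ij.1 ω ij.2) P
  M_indep_w : IndepFun (fun ω i => D.M i ω) (fun ω i => D.w i ω) P
  mean_eq : ∀ j, D.μM j = 1 - r j
  cov_eq : D.covM = Matrix.diagonal fun j => r j * (1 - r j)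

end MultData

end

end CoCoLasso

namespace CoCoLasso

/-! ### Deterministic analysis of the Lasso objective -/

section Deterministic

variable {ι : Type*} [Fintype ι]

theorem lassoObjective_add_sub {A : Matrix ι ι ℝ} (hA : A.PosSemidef) (r : ι → ℝ) (lam : ℝ)
    (b v : ι → ℝ) :
    lassoObjective A r lam (b + v) - lassoObjective A r lam b =
      1 / 2 * (v ⬝ᵥ A.mulVec v) +
        ∑ j, ((A.mulVec b - r) j * v j + lam * (|b j + v j| - |b j|)) := by
  have hsymm : b ⬝ᵥ A.mulVec v = v ⬝ᵥ A.mulVec b := by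
    have hT : A.transpose = A := by
      have := hA.1
      rwa [Matrix.IsHermitian, Matrix.conjTranspose_eq_transpose_of_trivial] at this
    rw [Matrix.dotProduct_mulVec, ← Matrix.mulVec_transpose, hT, dotProduct_comm]
  have h1 : ∑ j, ((A.mulVec b - r) j * v j + lam * (|b j + v j| - |b j|)) =
      (v ⬝ᵥ A.mulVec b - r ⬝ᵥ v) + lam * (∑ j, |b j + v j| - ∑ j, |b j|) := by
    rw [Finset.sum_add_distrib, ← Finset.mul_sum, Finset.sum_sub_distrib]
    congr 1
    simp only [dotProduct, Pi.sub_apply, ← Finset.sum_sub_distrib]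
    exact Finset.sum_congr rfl fun j _ => by ring
  rw [h1]
  unfold lassoObjective
  simp only [Matrix.mulVec_add, dotProduct_add, add_dotProduct, Pi.add_apply, hsymm]
  ring

theorem lassoObjective_eq_add {A : Matrix ι ι ℝ} (hA : A.PosSemidef) (r : ι → ℝ) (lam : ℝ)
    (b b' : ι → ℝ) :
    lassoObjective A r lam b' = lassoObjective A r lam b +
      (1 / 2 * ((b' - b) ⬝ᵥ A.mulVec (b' - b)) +
        ∑ j, ((A.mulVec b - r) j * (b' j - b j) + lam * (|b' j| - |b j|))) := by
  have := lassoObjective_add_sub hA r lam b (b' - b)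
  simp only [add_sub_cancel, Pi.sub_apply] at this ⊢
  linarith

theorem dotProduct_mulVec_self_nonneg {A : Matrix ι ι ℝ} (hA : A.PosSemidef) (v : ι → ℝ) :
    0 ≤ v ⬝ᵥ A.mulVec v := by
  simpa using hA.dotProduct_mulVec_nonneg v

/-- If the gradient of the quadratic part at some point of a closed set is small compared with the
penalty, the Lasso objective attains its minimum over this set. -/
theorem exists_lassoObjective_min_on {A : Matrix ι ι ℝ} (hA : A.PosSemidef) {r β : ι → ℝ}
    {lam : ℝ} (hlam : 0 < lam) (hg : ∀ j, |(A.mulVec β - r) j| ≤ lam / 2)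
    {T : Set (ι → ℝ)} (hT : IsClosed T) (hβ : β ∈ T) :
    ∃ b ∈ T, ∀ b' ∈ T, lassoObjective A r lam b ≤ lassoObjective A r lam b' := by
  have hcont : Continuous (lassoObjective A r lam) := by
    unfold lassoObjective dotProduct Matrix.mulVec dotProduct
    fun_prop
  have hlow : ∀ b, lassoObjective A r lam β +
      lam * (1 / 2 * ∑ j, |b j - β j| - 2 * ∑ j, |β j|) ≤ lassoObjective A r lam b := by
    intro b
    rw [lassoObjective_eq_add hA r lam β b]
    have h1 := dotProduct_mulVec_self_nonneg hA (b - β)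
    have h2 : lam * (1 / 2 * ∑ j, |b j - β j| - 2 * ∑ j, |β j|) ≤
        ∑ j, ((A.mulVec β - r) j * (b j - β j) + lam * (|b j| - |β j|)) := by
      rw [Finset.mul_sum, Finset.mul_sum, ← Finset.sum_sub_distrib, Finset.mul_sum]
      refine Finset.sum_le_sum fun j _ => ?_
      have h3 : -(lam / 2 * |b j - β j|) ≤ (A.mulVec β - r) j * (b j - β j) := by
        have := neg_abs_le ((A.mulVec β - r) j * (b j - β j))
        rw [abs_mul] at this
        nlinarith [hg j, abs_nonneg (b j - β j)]
      have h4 : |b j - β j| ≤ |b j| + |β j| := abs_sub _ _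
      nlinarith
    linarith
  have hcomp : IsCompact (T ∩ {b | ∑ j, |b j - β j| ≤ 4 * ∑ j, |β j|}) := by
    apply Metric.isCompact_of_isClosed_isBounded
    · refine hT.inter (isClosed_le ?_ continuous_const)
      fun_prop
    · refine (Metric.isBounded_closedBall (x := β) (r := 4 * ∑ j, |β j|)).subset ?_
      rintro b ⟨-, hb⟩
      rw [Metric.mem_closedBall, dist_eq_norm, pi_norm_le_iff_of_nonneg (by positivity)]
      intro j
      refine le_trans ?_ hb
      exact Finset.single_le_sum (f := fun j => |b j - β j|) (fun _ _ => abs_nonneg _)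
        (Finset.mem_univ j)
  have hβ' : β ∈ T ∩ {b | ∑ j, |b j - β j| ≤ 4 * ∑ j, |β j|} := by
    refine ⟨hβ, ?_⟩
    simp only [Set.mem_ofPred_eq, sub_self, abs_zero, Finset.sum_const_zero]
    positivity
  obtain ⟨b, hb, hmin⟩ := hcomp.exists_isMinOn ⟨β, hβ'⟩ hcont.continuousOn
  refine ⟨b, hb.1, fun b' hb' => ?_⟩
  by_cases h : ∑ j, |b' j - β j| ≤ 4 * ∑ j, |β j|
  · exact hmin ⟨hb', h⟩
  · have h1 := hmin hβ'
    have h2 := hlow b'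
    push Not at h
    have : 0 ≤ lam * (1 / 2 * ∑ j, |b' j - β j| - 2 * ∑ j, |β j|) :=
      mul_nonneg hlam.le (by linarith)
    simp only [Set.mem_ofPred_eq] at h1
    linarith

theorem sum_abs_le_sqrt_card_mul (S : Finset ι) (v : ι → ℝ) :
    ∑ j ∈ S, |v j| ≤ Real.sqrt S.card * Real.sqrt (∑ j, v j ^ 2) := by
  rw [← Real.sqrt_mul (Nat.cast_nonneg _)]
  apply Real.le_sqrt_of_sq_le
  refine (sq_sum_le_card_mul_sum_sq (s := S) (f := fun j => |v j|)).trans ?_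
  simp only [sq_abs]
  gcongr
  exact Finset.subset_univ S

variable [DecidableEq ι]

/-- Error bounds for the Lasso under a restricted eigenvalue condition. -/
theorem IsLassoMin.error_bounds {A : Matrix ι ι ℝ} (hA : A.PosSemidef) {r β b : ι → ℝ}
    {lam κ : ℝ} {S : Finset ι} (hS : ∀ j ∉ S, β j = 0) (hlam : 0 < lam) (hκ : 0 < κ)
    (hg : ∀ j, |(A.mulVec β - r) j| ≤ lam / 2)
    (hRE : ∀ v : ι → ℝ, ∑ j ∈ Sᶜ, |v j| ≤ 3 * ∑ j ∈ S, |v j| →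
      κ * ∑ j, v j ^ 2 ≤ v ⬝ᵥ A.mulVec v)
    (hb : IsLassoMin A r lam b) :
    Real.sqrt (∑ j, (b j - β j) ^ 2) ≤ 3 * lam * Real.sqrt S.card / κ ∧
      ∑ j, |b j - β j| ≤ 12 * lam * S.card / κ := by
  set v : ι → ℝ := b - β with hv
  have hvj : ∀ j, b j - β j = v j := fun j => rfl
  simp only [hvj]
  set a := ∑ j ∈ S, |v j| with ha
  set c := ∑ j ∈ Sᶜ, |v j| with hc
  have hac : ∑ j, |v j| = a + c := (Finset.sum_add_sum_compl S _).symm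
  have hbasic : 1 / 2 * (v ⬝ᵥ A.mulVec v) ≤ lam * (3 / 2 * a - 1 / 2 * c) := by
    have h0 := hb β
    rw [lassoObjective_eq_add hA r lam β b] at h0
    have h1 : lam * (1 / 2 * c - 3 / 2 * a) ≤
        ∑ j, ((A.mulVec β - r) j * (b j - β j) + lam * (|b j| - |β j|)) := by
      have hpt : ∀ j, -(lam / 2 * |v j|) ≤ (A.mulVec β - r) j * (b j - β j) := by
        intro j
        have := neg_abs_le ((A.mulVec β - r) j * v j)
        rw [abs_mul] at this
        rw [hvj]
        nlinarith [hg j, abs_nonneg (v j)]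
      rw [← Finset.sum_add_sum_compl S]
      have e1 : -(3 / 2 * lam * a) ≤
          ∑ j ∈ S, ((A.mulVec β - r) j * (b j - β j) + lam * (|b j| - |β j|)) := by
        rw [ha, Finset.mul_sum, ← Finset.sum_neg_distrib]
        refine Finset.sum_le_sum fun j _ => ?_
        have h4 : |β j| - |b j| ≤ |v j| := by
          rw [← hvj, abs_sub_comm]; exact abs_sub_abs_le_abs_sub _ _
        nlinarith [hpt j]
      have e2 : 1 / 2 * lam * c ≤
          ∑ j ∈ Sᶜ, ((A.mulVec β - r) j * (b j - β j) + lam * (|b j| - |β j|)) := by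
        rw [hc, Finset.mul_sum]
        refine Finset.sum_le_sum fun j hj => ?_
        have h5 : β j = 0 := hS j (by simpa using hj)
        have h6 : b j = v j := by rw [← hvj, h5, sub_zero]
        have := hpt j
        rw [h5, abs_zero, h6] at *
        nlinarith
      linarith
    rw [← hv] at h0
    linarith
  have hnn := dotProduct_mulVec_self_nonneg hA v
  have hcone : c ≤ 3 * a := by
    have : 0 ≤ 3 / 2 * a - 1 / 2 * c := by
      by_contra hneg
      push Not at hneg
      nlinarith
    linarith
  have hc0 : 0 ≤ c := Finset.sum_nonneg fun _ _ => abs_nonneg _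
  have hre := hRE v hcone
  set N := Real.sqrt (∑ j, v j ^ 2) with hN
  have hN2 : ∑ j, v j ^ 2 = N ^ 2 := (Real.sq_sqrt (Finset.sum_nonneg fun _ _ => sq_nonneg _)).symm
  have hN0 : 0 ≤ N := Real.sqrt_nonneg _
  have haN : a ≤ Real.sqrt S.card * N := sum_abs_le_sqrt_card_mul S v
  have hs0 : 0 ≤ Real.sqrt S.card := Real.sqrt_nonneg _
  have hbound : N * κ ≤ 3 * lam * Real.sqrt S.card := by
    rcases hN0.eq_or_lt with h | h
    · rw [← h, zero_mul]; exact mul_nonneg (mul_nonneg (by norm_num) hlam.le) hs0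
    · have : κ * N ^ 2 ≤ 3 * lam * (Real.sqrt S.card * N) := by
        rw [hN2] at hre
        nlinarith
      nlinarith
  refine ⟨(le_div_iff₀ hκ).2 hbound, (le_div_iff₀ hκ).2 ?_⟩
  rw [hac]
  have hss : Real.sqrt S.card * Real.sqrt S.card = S.card :=
    Real.mul_self_sqrt (Nat.cast_nonneg _)
  have h1 : (a + c) * κ ≤ 4 * (Real.sqrt S.card * N) * κ :=
    mul_le_mul_of_nonneg_right (by linarith) hκ.le
  have h2 := mul_le_mul_of_nonneg_left hbound hs0
  linear_combination h1 + 4 * h2 + 12 * lam * hss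

/-- First-order conditions for a one-dimensional penalized quadratic function. -/
theorem kkt_of_forall_nonneg {h a b lam : ℝ} (ha : 0 ≤ a)
    (H : ∀ t : ℝ, 0 ≤ a * t ^ 2 + h * t + lam * (|b + t| - |b|)) (hlam : 0 ≤ lam) :
    |h| ≤ lam ∧ h * b = -(lam * |b|) := by
  have hh : |h| ≤ lam := by
    by_contra hcon
    push Not at hcon
    have hu : ∀ u : ℝ, 0 < u → 0 ≤ a * h ^ 2 * u - (h ^ 2 - lam * |h|) := by
      intro u hu
      have h1 := H (-(u * h))
      have h2 : |b + -(u * h)| - |b| ≤ u * |h| := by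
        have := abs_add_le b (-(u * h))
        rw [abs_neg, abs_mul, abs_of_pos hu] at this
        linarith
      have h3 : 0 ≤ u * (a * h ^ 2 * u - (h ^ 2 - lam * |h|)) := by
        nlinarith
      exact nonneg_of_mul_nonneg_right h3 hu
    have hpos : 0 < h ^ 2 - lam * |h| := by
      rw [← sq_abs]; nlinarith [abs_nonneg h]
    have hden : 0 < a * h ^ 2 + 1 := by positivity
    have := hu ((h ^ 2 - lam * |h|) / (2 * (a * h ^ 2 + 1))) (by positivity)
    have h4 : a * h ^ 2 * ((h ^ 2 - lam * |h|) / (2 * (a * h ^ 2 + 1))) ≤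
        (h ^ 2 - lam * |h|) / 2 := by
      rw [mul_div_assoc', div_le_div_iff₀ (by positivity) (by norm_num)]
      nlinarith
    linarith
  refine ⟨hh, ?_⟩
  have hge : -(lam * |b|) ≤ h * b := by
    have := neg_abs_le (h * b)
    rw [abs_mul] at this
    nlinarith [abs_nonneg b]
  refine le_antisymm ?_ hge
  by_contra hcon
  push Not at hcon
  have hu : ∀ u : ℝ, 0 < u → u ≤ 1 → 0 ≤ a * b ^ 2 * u - (h * b + lam * |b|) := by
    intro u hu hu1
    have h1 := H (-(u * b))
    have h2 : |b + -(u * b)| - |b| = -(u * |b|) := by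
      rw [show b + -(u * b) = (1 - u) * b by ring, abs_mul, abs_of_nonneg (by linarith)]
      ring
    rw [h2] at h1
    have h3 : 0 ≤ u * (a * b ^ 2 * u - (h * b + lam * |b|)) := by nlinarith
    exact nonneg_of_mul_nonneg_right h3 hu
  set q := h * b + lam * |b| with hq
  have hqpos : 0 < q := by linarith
  have hden : 0 < a * b ^ 2 + q := by positivity
  have := hu (q / (2 * (a * b ^ 2 + q))) (by positivity) (by
    rw [div_le_one (by positivity)]; nlinarith [mul_nonneg ha (sq_nonneg b)])
  have h4 : a * b ^ 2 * (q / (2 * (a * b ^ 2 + q))) ≤ q / 2 := by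
    rw [mul_div_assoc', div_le_div_iff₀ (by positivity) (by norm_num)]
    nlinarith [mul_nonneg ha (sq_nonneg b)]
  linarith

/-- Primal-dual witness argument for a perturbation `A` of a Gram matrix `G` satisfying the
irrepresentable condition. -/
theorem exists_unique_isLassoMin_of_irrepresentable {A G : Matrix ι ι ℝ} (hA : A.PosSemidef)
    {r β : ι → ℝ} {lam γ φ η : ℝ} {S : Finset ι} (hS : ∀ j ∉ S, β j = 0) (hlam : 0 < lam)
    (hγ0 : 0 < γ) (hγ1 : γ ≤ 1) (hφ0 : 0 ≤ φ) (hη0 : 0 ≤ η) (hηφ : η * φ ≤ γ / 16)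
    (hφ : ∀ v : ι → ℝ, (∀ j ∉ S, v j = 0) → ∀ m, (∀ j ∈ S, |G.mulVec v j| ≤ m) →
      ∀ j ∈ S, |v j| ≤ φ * m)
    (hγ : ∀ v : ι → ℝ, (∀ j ∉ S, v j = 0) → ∀ m, (∀ j ∈ S, |G.mulVec v j| ≤ m) →
      ∀ j ∉ S, |G.mulVec v j| ≤ (1 - γ) * m)
    (hη : ∀ v : ι → ℝ, (∀ j ∉ S, v j = 0) → ∀ j, |A.mulVec v j - G.mulVec v j| ≤ η * ‖v‖)
    (hg : ∀ j, |(A.mulVec β - r) j| ≤ γ * lam / 4) :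
    ∃ b, IsLassoMin A r lam b ∧ (∀ b', IsLassoMin A r lam b' → b' = b) ∧
      (∀ j, j ∉ S → b j = 0) ∧ (∀ j ∈ S, |b j - β j| ≤ 2 * φ * lam) := by
  have hT : IsClosed {b : ι → ℝ | ∀ j ∉ S, b j = 0} := by
    simp only [Set.ofPred_forall]
    exact isClosed_iInter fun j => isClosed_iInter fun _ =>
      isClosed_eq (continuous_apply j) continuous_const
  obtain ⟨b, hbS, hbmin⟩ := exists_lassoObjective_min_on (T := {b : ι → ℝ | ∀ j ∉ S, b j = 0}) hA
    hlam (fun j => (hg j).trans (by nlinarith)) hT hS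
  set h : ι → ℝ := A.mulVec b - r with hh
  have hkkt : ∀ j ∈ S, |h j| ≤ lam ∧ h j * b j = -(lam * |b j|) := by
    intro j hj
    have hAjj : 0 ≤ 1 / 2 * A j j := by
      have := hA.diag_nonneg (i := j)
      linarith
    refine kkt_of_forall_nonneg hAjj (fun t => ?_) hlam.le
    have h1 := hbmin (b + Pi.single j t) (by
      intro i hi
      have : i ≠ j := fun h => hi (h ▸ hj)
      simp [hbS i hi, this])
    have h2 := lassoObjective_add_sub hA r lam b (Pi.single j t)
    have h3 : (Pi.single j t : ι → ℝ) ⬝ᵥ A.mulVec (Pi.single j t) = A j j * t ^ 2 := by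
      rw [single_dotProduct, Matrix.mulVec_single]
      simp; ring
    have h4 : ∑ i, ((A.mulVec b - r) i * (Pi.single j t : ι → ℝ) i +
        lam * (|b i + (Pi.single j t : ι → ℝ) i| - |b i|)) =
        h j * t + lam * (|b j + t| - |b j|) := by
      rw [Finset.sum_eq_single j]
      · simp [hh]
      · intro i _ hij
        simp [hij]
      · simp
    rw [h3, h4] at h2
    linarith
  set d : ι → ℝ := b - β with hd
  have hdS : ∀ j ∉ S, d j = 0 := fun j hj => by
    simp only [hd, Pi.sub_apply, hbS j hj, hS j hj, sub_zero]
  have hAd : A.mulVec d = h - (A.mulVec β - r) := by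
    rw [hd, Matrix.mulVec_sub, hh]; abel
  have hGd : ∀ j ∈ S, |G.mulVec d j| ≤ lam + γ * lam / 4 + η * ‖d‖ := by
    intro j hj
    have e1 := hη d hdS j
    have e2 : |A.mulVec d j| ≤ lam + γ * lam / 4 := by
      rw [hAd]
      exact (abs_sub _ _).trans (add_le_add (hkkt j hj).1 (hg j))
    have e3 : G.mulVec d j = A.mulVec d j - (A.mulVec d j - G.mulVec d j) := by ring
    rw [e3]
    exact (abs_sub _ _).trans (add_le_add e2 e1)
  have hdn : ‖d‖ ≤ φ * (lam + γ * lam / 4 + η * ‖d‖) := by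
    rw [pi_norm_le_iff_of_nonneg (by positivity)]
    intro j
    by_cases hj : j ∈ S
    · exact hφ d hdS _ hGd j hj
    · rw [hdS j hj, norm_zero]; positivity
  have hd0 : 0 ≤ ‖d‖ := norm_nonneg d
  have hdn2 : ‖d‖ ≤ 2 * φ * lam := by
    have e1 : φ * (η * ‖d‖) ≤ ‖d‖ / 16 := by
      have : (η * φ) * ‖d‖ ≤ 1 / 16 * ‖d‖ := by gcongr; linarith
      linarith
    have e2 : φ * (γ * lam) ≤ φ * lam := by
      gcongr; nlinarith
    nlinarith [mul_nonneg hφ0 hlam.le]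
  have hηd : η * ‖d‖ ≤ γ * lam / 8 := by
    calc η * ‖d‖ ≤ η * (2 * φ * lam) := by gcongr
      _ = 2 * (η * φ) * lam := by ring
      _ ≤ 2 * (γ / 16) * lam := by gcongr
      _ = γ * lam / 8 := by ring
  have hdual : ∀ j ∉ S, |h j| < lam := by
    intro j hj
    have e1 := hη d hdS j
    have e2 := hγ d hdS _ hGd j hj
    have e3 : h j = (A.mulVec β - r) j + (A.mulVec d j - G.mulVec d j) + G.mulVec d j := by
      rw [hAd]
      change h j = (A.mulVec β - r) j + (h j - (A.mulVec β - r) j - G.mulVec d j) + G.mulVec d j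
      ring
    have e4 : |h j| ≤ γ * lam / 4 + η * ‖d‖ + (1 - γ) * (lam + γ * lam / 4 + η * ‖d‖) := by
      rw [e3]
      exact (abs_add_le _ _).trans
        (add_le_add ((abs_add_le _ _).trans (add_le_add (hg j) e1)) e2)
    have e5 : (1 - γ) * (lam + γ * lam / 4 + η * ‖d‖) ≤
        (1 - γ) * lam + (γ * lam / 4 + γ * lam / 8) := by
      have : (1 - γ) * (γ * lam / 4 + η * ‖d‖) ≤ 1 * (γ * lam / 4 + γ * lam / 8) := by
        gcongr
        linarith
      linarith
    have : 0 < γ * lam := by positivity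
    linarith
  have hterm : ∀ b' : ι → ℝ, ∀ j, 0 ≤ h j * (b' j - b j) + lam * (|b' j| - |b j|) := by
    intro b' j
    by_cases hj : j ∈ S
    · obtain ⟨k1, k2⟩ := hkkt j hj
      have : -(h j * b' j) ≤ lam * |b' j| := by
        refine (neg_le_abs _).trans ?_
        rw [abs_mul]; gcongr
      linarith
    · have : -(h j * b' j) ≤ lam * |b' j| := by
        refine (neg_le_abs _).trans ?_
        rw [abs_mul]; gcongr; exact (hdual j hj).le
      rw [hbS j hj, abs_zero]; linarith
  refine ⟨b, fun b' => ?_, fun b' hb' => ?_, hbS, fun j _ => ?_⟩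
  · rw [lassoObjective_eq_add hA r lam b b']
    have h1 := dotProduct_mulVec_self_nonneg hA (b' - b)
    have h2 := Finset.sum_nonneg fun j (_ : j ∈ Finset.univ) => hterm b' j
    linarith
  · have h0 := hb' b
    rw [lassoObjective_eq_add hA r lam b b'] at h0
    set v : ι → ℝ := b' - b with hv
    have h1 := dotProduct_mulVec_self_nonneg hA v
    have h2 := Finset.sum_nonneg fun j (_ : j ∈ Finset.univ) => hterm b' j
    have hq : v ⬝ᵥ A.mulVec v = 0 := by linarith
    have hs : ∑ j, (h j * (b' j - b j) + lam * (|b' j| - |b j|)) = 0 := by linarith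
    have hz := (Finset.sum_eq_zero_iff_of_nonneg fun j _ => hterm b' j).1 hs
    have hvS : ∀ j ∉ S, v j = 0 := by
      intro j hj
      have e1 := hz j (Finset.mem_univ j)
      rw [hbS j hj, abs_zero, sub_zero, sub_zero] at e1
      have e2 : -(|h j| * |b' j|) ≤ h j * b' j := by
        rw [← abs_mul]; exact neg_abs_le _
      have e3 : |b' j| = 0 := by
        have := hdual j hj
        by_contra hne
        have : 0 < |b' j| := lt_of_le_of_ne (abs_nonneg _) (Ne.symm hne)
        nlinarith
      rw [hv, Pi.sub_apply, hbS j hj, sub_zero]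
      exact abs_eq_zero.1 e3
    have hAv : A.mulVec v = 0 := by
      apply (hA.dotProduct_mulVec_zero_iff v).1
      simpa using hq
    have hvn : ‖v‖ ≤ φ * (η * ‖v‖) := by
      rw [pi_norm_le_iff_of_nonneg (by positivity)]
      intro j
      by_cases hj : j ∈ S
      · refine hφ v hvS _ (fun i _ => ?_) j hj
        have := hη v hvS i
        rwa [hAv, Pi.zero_apply, zero_sub, abs_neg] at this
      · rw [hvS j hj, norm_zero]; positivity
    have hv0 : 0 ≤ ‖v‖ := norm_nonneg v
    have : (η * φ) * ‖v‖ ≤ 1 / 16 * ‖v‖ := by gcongr; linarith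
    have : ‖v‖ = 0 := by linarith
    exact sub_eq_zero.1 (norm_eq_zero.1 this)
  · exact (norm_le_pi_norm d j).trans hdn2

end Deterministic

/-! ### The deterministic part of the argument for the surrogate matrices -/

theorem abs_le_maxNorm {ι κ : Type*} [Fintype ι] [Fintype κ] (K : Matrix ι κ ℝ) (i : ι) (j : κ) :
    |K i j| ≤ maxNorm K := by
  rw [maxNorm_eq_norm]
  exact (norm_le_pi_norm (fun j => K i j) j).trans
    (norm_le_pi_norm (fun i j => K i j : ι → κ → ℝ) i)

theorem maxNorm_le {ι κ : Type*} {K : Matrix ι κ ℝ} {δ : ℝ} (hδ : 0 ≤ δ)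
    (h : ∀ i j, |K i j| ≤ δ) : maxNorm K ≤ δ :=
  Real.iSup_le (fun i => Real.iSup_le (fun j => h i j) hδ) hδ

theorem infNorm_nonneg {ι κ : Type*} [Fintype κ] (K : Matrix ι κ ℝ) : 0 ≤ infNorm K :=
  Real.iSup_nonneg fun _ => Finset.sum_nonneg fun _ _ => abs_nonneg _

theorem abs_mulVec_le {ι κ : Type*} [Finite ι] [Fintype κ] (K : Matrix ι κ ℝ) {x : κ → ℝ} {m : ℝ}
    (hm : 0 ≤ m) (hx : ∀ j, |x j| ≤ m) (i : ι) : |K.mulVec x i| ≤ infNorm K * m := by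
  calc |K.mulVec x i| ≤ ∑ j, |K i j * x j| := Finset.abs_sum_le_sum_abs _ _
    _ ≤ ∑ j, |K i j| * m := by
        refine Finset.sum_le_sum fun j _ => ?_
        rw [abs_mul]
        exact mul_le_mul_of_nonneg_left (hx j) (abs_nonneg _)
    _ = (∑ j, |K i j|) * m := by rw [Finset.sum_mul]
    _ ≤ infNorm K * m := by
        refine mul_le_mul_of_nonneg_right ?_ hm
        exact le_ciSup (f := fun i => ∑ j, |K i j|) (Set.finite_range _).bddAbove i

/-- A nearest positive semidefinite matrix is at most twice as far from a positive semidefinite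
matrix as the original one. -/
theorem IsNearestPSD.abs_sub_le {ι : Type*} [Fintype ι] {K A G : Matrix ι ι ℝ}
    (hA : IsNearestPSD K A) (hG : G.PosSemidef) {δ : ℝ} (hδ : 0 ≤ δ)
    (h : ∀ i j, |K i j - G i j| ≤ δ) (i j : ι) : |A i j - G i j| ≤ 2 * δ := by
  have h1 : |(K - A) i j| ≤ δ :=
    (abs_le_maxNorm _ i j).trans ((hA.2 G hG).trans (maxNorm_le hδ h))
  rw [Matrix.sub_apply] at h1
  have h2 : A i j - G i j = (K i j - G i j) - (K i j - A i j) := by ring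
  rw [h2]
  exact (abs_sub _ _).trans (by linarith [h i j])

namespace MultData

variable {n p : ℕ} {Ω : Type*} (D : MultData n p Ω)

/-- The noise part `X'w / n` of `ρ`. -/
noncomputable def noiseCorr (ω : Ω) : Fin p → ℝ := fun j => (n : ℝ)⁻¹ * ∑ i, D.X i j * D.w i ω

theorem posSemidef_Sig : D.Sig.PosSemidef := by
  unfold Sig
  refine Matrix.PosSemidef.smul ?_ (by positivity)
  have := Matrix.posSemidef_conjTranspose_mul_self D.X
  rwa [Matrix.conjTranspose_eq_transpose_of_trivial] at this

theorem rho_eq (ω : Ω) (j : Fin p) : D.rho ω j = D.Sig.mulVec D.β j + D.noiseCorr ω j := by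
  have h1 : D.y ω = D.X.mulVec D.β + fun i => D.w i ω := rfl
  unfold rho noiseCorr Sig
  rw [h1, Matrix.mulVec_add, Matrix.smul_mulVec, ← Matrix.mulVec_mulVec, smul_add]
  simp [Matrix.mulVec, dotProduct]

theorem beta_eq_zero {j : Fin p} (hj : j ∉ D.S) : D.β j = 0 := by
  simpa [S] using hj

theorem abs_beta_le (j : Fin p) : |D.β j| ≤ D.B := norm_le_pi_norm D.β j

theorem B_nonneg : 0 ≤ D.B := norm_nonneg _

theorem s_nonneg : 0 ≤ D.s := Nat.cast_nonneg _

variable {D} {ω : Ω} {A : Matrix (Fin p) (Fin p) ℝ}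

theorem abs_mulVec_sub_le {E : ℝ} (hE : ∀ j k, |A j k - D.Sig j k| ≤ E)
    {v : Fin p → ℝ} (hv : ∀ j ∉ D.S, v j = 0) (j : Fin p) :
    |A.mulVec v j - D.Sig.mulVec v j| ≤ E * D.s * ‖v‖ := by
  have h1 : A.mulVec v j - D.Sig.mulVec v j = ∑ k ∈ D.S, (A j k - D.Sig j k) * v k := by
    rw [Finset.sum_subset (Finset.subset_univ D.S) (fun k _ hk => by rw [hv k hk, mul_zero])]
    simp only [Matrix.mulVec, dotProduct, ← Finset.sum_sub_distrib, sub_mul]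
  rw [h1]
  calc |∑ k ∈ D.S, (A j k - D.Sig j k) * v k| ≤ ∑ k ∈ D.S, |(A j k - D.Sig j k) * v k| :=
        Finset.abs_sum_le_sum_abs _ _
    _ ≤ ∑ _k ∈ D.S, E * ‖v‖ := by
        refine Finset.sum_le_sum fun k _ => ?_
        rw [abs_mul]
        exact mul_le_mul (hE j k) (norm_le_pi_norm v k) (abs_nonneg _)
          ((abs_nonneg _).trans (hE j k))
    _ = E * D.s * ‖v‖ := by
        rw [Finset.sum_const, nsmul_eq_mul]; unfold s; ring

theorem abs_gradient_le {E a : ℝ} (hE : ∀ j k, |A j k - D.Sig j k| ≤ E)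
    (hρ : ∀ j, |D.rhoTilde ω j - D.rho ω j| ≤ a) (hw : ∀ j, |D.noiseCorr ω j| ≤ a) (j : Fin p) :
    |(A.mulVec D.β - D.rhoTilde ω) j| ≤ 2 * a + E * D.s * D.B := by
  have h1 := abs_mulVec_sub_le hE (fun _ => D.beta_eq_zero) j
  have h2 : (A.mulVec D.β - D.rhoTilde ω) j = (A.mulVec D.β j - D.Sig.mulVec D.β j)
      - D.noiseCorr ω j - (D.rhoTilde ω j - D.rho ω j) := by
    rw [D.rho_eq, Pi.sub_apply]; ring
  rw [h2]
  refine (abs_sub _ _).trans ?_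
  have h3 := abs_sub (A.mulVec D.β j - D.Sig.mulVec D.β j) (D.noiseCorr ω j)
  have h4 := hρ j
  have h5 := hw j
  unfold B
  linarith

theorem restrictedEigenvalue_mul_le {v : Fin p → ℝ}
    (hv : ∑ j ∈ D.Sᶜ, |v j| ≤ 3 * ∑ j ∈ D.S, |v j|) :
    D.restrictedEigenvalue * ∑ j, v j ^ 2 ≤ v ⬝ᵥ D.Sig.mulVec v := by
  by_cases h0 : v = 0
  · simp [h0]
  have hpos : 0 < ∑ j, v j ^ 2 := by
    obtain ⟨j, hj⟩ := Function.ne_iff.1 h0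
    exact Finset.sum_pos' (fun _ _ => sq_nonneg _)
      ⟨j, Finset.mem_univ j, by have : v j ≠ 0 := hj; positivity⟩
  rw [← le_div_iff₀ hpos]
  refine csInf_le ⟨0, ?_⟩ ⟨v, h0, hv, rfl⟩
  rintro _ ⟨x, -, -, rfl⟩
  exact div_nonneg (dotProduct_mulVec_self_nonneg D.posSemidef_Sig x)
    (Finset.sum_nonneg fun _ _ => sq_nonneg _)

theorem s_pos_of_restrictedEigenvalue_pos (h : 0 < D.restrictedEigenvalue) : 1 ≤ D.s := by
  unfold s
  rw [Nat.one_le_cast, Nat.one_le_iff_ne_zero, Ne, Finset.card_eq_zero]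
  intro hS
  apply h.ne'
  unfold restrictedEigenvalue
  convert Real.sInf_empty
  ext v
  simp only [Set.mem_ofPred_eq, Set.mem_empty_iff_false, iff_false, not_exists, not_and]
  intro x hx hc
  rw [hS] at hc
  simp only [Finset.compl_empty, Finset.sum_empty, mul_zero] at hc
  have h0 : ∑ j, |x j| = 0 := le_antisymm hc (Finset.sum_nonneg fun _ _ => abs_nonneg _)
  refine absurd (funext fun j => ?_) hx
  exact abs_eq_zero.1 ((Finset.sum_eq_zero_iff_of_nonneg fun _ _ => abs_nonneg _).1 h0 j
    (Finset.mem_univ j))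

theorem B_pos_of_s_pos (h : 1 ≤ D.s) : 0 < D.B := by
  have hne : D.S.Nonempty := by
    rw [← Finset.card_pos]
    unfold s at h
    exact_mod_cast (zero_lt_one.trans_le h)
  obtain ⟨j, hj⟩ := hne
  have : D.β j ≠ 0 := by simpa [S] using hj
  exact (abs_pos.2 this).trans_le (D.abs_beta_le j)

/-- Existence of and error bounds for the estimates on the event that the surrogates are close to
their targets. -/
theorem error_bounds_of_close {lam ε δ a : ℝ} (hΩ : 0 < D.restrictedEigenvalue) (hlam : 0 < lam)
    (hε : 0 ≤ ε) (hδ : 0 ≤ δ)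
    (hε2 : ε ≤ D.restrictedEigenvalue / (64 * D.s)) (hδa : 2 * a + 2 * δ * D.s * D.B ≤ lam / 2)
    (h1 : ∀ j k, |D.SigHat ω j k - D.Sig j k| ≤ ε) (h2 : ∀ j k, |D.SigHat ω j k - D.Sig j k| ≤ δ)
    (hρ : ∀ j, |D.rhoTilde ω j - D.rho ω j| ≤ a) (hw : ∀ j, |D.noiseCorr ω j| ≤ a)
    (hA : IsNearestPSD (D.SigHat ω) A) :
    (∃ b, IsLassoMin A (D.rhoTilde ω) lam b) ∧
      ∀ b, IsLassoMin A (D.rhoTilde ω) lam b →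
        Real.sqrt (∑ j, (b j - D.β j) ^ 2) ≤ 6 * lam * Real.sqrt D.s / D.restrictedEigenvalue ∧
        ∑ j, |b j - D.β j| ≤ 24 * lam * D.s / D.restrictedEigenvalue := by
  have hg : ∀ j, |(A.mulVec D.β - D.rhoTilde ω) j| ≤ lam / 2 := fun j =>
    (abs_gradient_le (hA.abs_sub_le D.posSemidef_Sig hδ h2) hρ hw j).trans hδa
  refine ⟨?_, fun b hb => ?_⟩
  · obtain ⟨b, -, hb⟩ := exists_lassoObjective_min_on hA.1 hlam hg isClosed_univ (Set.mem_univ D.β)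
    exact ⟨b, fun b' => hb b' (Set.mem_univ b')⟩
  · have hs := s_pos_of_restrictedEigenvalue_pos hΩ
    have hRE : ∀ v : Fin p → ℝ, ∑ j ∈ D.Sᶜ, |v j| ≤ 3 * ∑ j ∈ D.S, |v j| →
        D.restrictedEigenvalue / 2 * ∑ j, v j ^ 2 ≤ v ⬝ᵥ A.mulVec v := by
      intro v hv
      have e1 := restrictedEigenvalue_mul_le hv
      set V := ∑ j, v j ^ 2 with hV
      set L := ∑ j, |v j| with hL
      have hV0 : 0 ≤ V := Finset.sum_nonneg fun _ _ => sq_nonneg _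
      have e2 : L ≤ 4 * (Real.sqrt D.s * Real.sqrt V) := by
        have := sum_abs_le_sqrt_card_mul D.S v
        rw [hL, ← Finset.sum_add_sum_compl D.S]
        unfold s
        linarith
      have hL0 : 0 ≤ L := Finset.sum_nonneg fun _ _ => abs_nonneg _
      have e3 : L ^ 2 ≤ 16 * D.s * V := by
        calc L ^ 2 ≤ (4 * (Real.sqrt D.s * Real.sqrt V)) ^ 2 := by gcongr
          _ = 16 * (Real.sqrt D.s ^ 2) * (Real.sqrt V ^ 2) := by ring
          _ = 16 * D.s * V := by rw [Real.sq_sqrt D.s_nonneg, Real.sq_sqrt hV0]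
      have e4 : v ⬝ᵥ D.Sig.mulVec v - v ⬝ᵥ A.mulVec v ≤ 2 * ε * L ^ 2 := by
        have e5 : v ⬝ᵥ D.Sig.mulVec v - v ⬝ᵥ A.mulVec v =
            ∑ j, ∑ k, v j * (-(A j k - D.Sig j k) * v k) := by
          simp only [dotProduct, Matrix.mulVec, ← Finset.sum_sub_distrib, ← mul_sub,
            Finset.mul_sum]
          exact Finset.sum_congr rfl fun j _ => Finset.sum_congr rfl fun k _ => by ring
        rw [e5, hL, sq, Finset.sum_mul_sum, Finset.mul_sum]
        refine Finset.sum_le_sum fun j _ => ?_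
        rw [Finset.mul_sum]
        refine Finset.sum_le_sum fun k _ => (le_abs_self _).trans ?_
        rw [abs_mul, abs_mul, abs_neg]
        have := hA.abs_sub_le D.posSemidef_Sig hε h1 j k
        calc |v j| * (|A j k - D.Sig j k| * |v k|) ≤ |v j| * (2 * ε * |v k|) := by gcongr
          _ = 2 * ε * (|v j| * |v k|) := by ring
      have e6 : ε * (64 * D.s) ≤ D.restrictedEigenvalue := (le_div_iff₀ (by linarith)).1 hε2
      have e7 : 2 * ε * L ^ 2 ≤ D.restrictedEigenvalue / 2 * V := by
        calc 2 * ε * L ^ 2 ≤ 2 * ε * (16 * D.s * V) := by gcongr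
          _ = ε * (64 * D.s) / 2 * V := by ring
          _ ≤ _ := by gcongr
      linarith
    have := hb.error_bounds hA.1 (fun _ => D.beta_eq_zero) hlam (half_pos hΩ) hg hRE
    refine ⟨this.1.trans_eq ?_, this.2.trans_eq ?_⟩
    · unfold s; field_simp; ring
    · unfold s; field_simp; ring

theorem sum_subtype_mul_eq {v : Fin p → ℝ} (hv : ∀ j ∉ D.S, v j = 0) (c : Fin p → ℝ) :
    ∑ k : {j // j ∈ D.S}, c k * v k = ∑ k, c k * v k := by
  rw [Finset.sum_coe_sort D.S (fun k => c k * v k)]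
  exact Finset.sum_subset (Finset.subset_univ _) fun k _ hk => by rw [hv k hk, mul_zero]

theorem Irrepresentable.isUnit_det (h : D.Irrepresentable) : IsUnit D.SigSS.det := by
  rw [← Matrix.isUnit_iff_isUnit_det]
  by_contra hcon
  have h0 : (0 : ℝ) ∈ spectrum ℝ D.SigSS := spectrum.zero_mem_iff ℝ |>.2 hcon
  have : D.Cmin ≤ 0 := csInf_le (Matrix.finite_spectrum D.SigSS).bddBelow h0
  exact absurd h.2 (not_lt.2 this)

theorem Irrepresentable.one_le_s (h : D.Irrepresentable) : 1 ≤ D.s := by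
  unfold s
  rw [Nat.one_le_cast, Nat.one_le_iff_ne_zero, Ne, Finset.card_eq_zero]
  intro hS
  have : IsEmpty {j // j ∈ D.S} := ⟨fun j => by simpa [hS] using j.2⟩
  have h0 : D.Cmin = 0 := by
    unfold Cmin minEigenvalue
    rw [spectrum.of_subsingleton, Real.sInf_empty]
  exact h.2.ne' h0

theorem gam_le_one : D.gam ≤ 1 := by
  unfold gam
  linarith [infNorm_nonneg (D.SigScS * D.SigSS⁻¹)]

/-- Support recovery and the `ℓ_∞` bound on the event that the surrogates are close to their
targets. -/
theorem support_recovery_of_close {lam δ a : ℝ} (hI : D.Irrepresentable) (hlam : 0 < lam)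
    (hδ : 0 ≤ δ) (hδφ : 2 * δ * D.s * infNorm D.SigSS⁻¹ ≤ D.gam / 16)
    (hδa : 2 * a + 2 * δ * D.s * D.B ≤ D.gam * lam / 4)
    (h2 : ∀ j k, |D.SigHat ω j k - D.Sig j k| ≤ δ)
    (hρ : ∀ j, |D.rhoTilde ω j - D.rho ω j| ≤ a) (hw : ∀ j, |D.noiseCorr ω j| ≤ a)
    (hA : IsNearestPSD (D.SigHat ω) A) :
    ∃ b, IsLassoMin A (D.rhoTilde ω) lam b ∧
      (∀ b', IsLassoMin A (D.rhoTilde ω) lam b' → b' = b) ∧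
      (∀ j, j ∉ D.S → b j = 0) ∧
      (∀ j ∈ D.S, |b j - D.β j| ≤ D.kap * lam) ∧
      (D.kap * lam ≤ D.betaMin →
        ∀ j ∈ D.S, SignType.sign (b j) = SignType.sign (D.β j)) := by
  have hφ0 := infNorm_nonneg D.SigSS⁻¹
  have hs := hI.one_le_s
  have hne : D.S.Nonempty := by
    rw [← Finset.card_pos]
    unfold s at hs
    exact_mod_cast (zero_lt_one.trans_le hs)
  have hE := hA.abs_sub_le D.posSemidef_Sig hδ h2
  have hres : ∀ v : Fin p → ℝ, (∀ j ∉ D.S, v j = 0) → ∀ j : {j // j ∈ D.S},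
      D.SigSS.mulVec (fun k => v k) j = D.Sig.mulVec v j := fun v hv j =>
    sum_subtype_mul_eq hv (fun k => D.Sig j k)
  have hinv : ∀ v : Fin p → ℝ, D.SigSS⁻¹.mulVec (D.SigSS.mulVec (fun k => v k)) =
      fun k : {j // j ∈ D.S} => v k := fun v => by
    rw [Matrix.mulVec_mulVec, Matrix.nonsing_inv_mul _ hI.isUnit_det, Matrix.one_mulVec]
  obtain ⟨b, hmin, huniq, hsupp, hbd⟩ := exists_unique_isLassoMin_of_irrepresentable
    (G := D.Sig) (γ := D.gam) (φ := infNorm D.SigSS⁻¹) (η := 2 * δ * D.s)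
    hA.1 (fun _ => D.beta_eq_zero) hlam hI.1 gam_le_one hφ0 (by have := D.s_nonneg; positivity) hδφ
    (by
      intro v hv m hm j hj
      have hm0 : 0 ≤ m := (abs_nonneg _).trans (hm j hj)
      have := abs_mulVec_le D.SigSS⁻¹ (x := D.SigSS.mulVec (fun k => v k)) hm0
        (fun k => by rw [hres v hv]; exact hm k k.2) ⟨j, hj⟩
      rwa [hinv] at this)
    (by
      intro v hv m hm j hj
      obtain ⟨i, hi⟩ := hne
      have hm0 : 0 ≤ m := (abs_nonneg _).trans (hm i hi)
      have := abs_mulVec_le (D.SigScS * D.SigSS⁻¹) (x := D.SigSS.mulVec (fun k => v k)) hm0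
        (fun k => by rw [hres v hv]; exact hm k k.2) ⟨j, hj⟩
      rw [← Matrix.mulVec_mulVec, hinv] at this
      have e : D.SigScS.mulVec (fun k => v k) ⟨j, hj⟩ = D.Sig.mulVec v j :=
        sum_subtype_mul_eq hv (fun k => D.Sig j k)
      rw [e] at this
      unfold gam
      linarith)
    (fun v hv j => abs_mulVec_sub_le hE hv j)
    (fun j => (abs_gradient_le hE hρ hw j).trans hδa)
  have hC : 0 < (Real.sqrt D.Cmin)⁻¹ := inv_pos.2 (Real.sqrt_pos.2 hI.2)
  have hlt : 2 * infNorm D.SigSS⁻¹ * lam < D.kap * lam := by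
    refine mul_lt_mul_of_pos_right ?_ hlam
    unfold kap
    linarith
  refine ⟨b, hmin, huniq, hsupp, fun j hj => (hbd j hj).trans hlt.le, fun hβ j hj => ?_⟩
  have hmin : D.betaMin ≤ |D.β j| := by
    refine ciInf_le (f := fun j : {j // j ∈ D.S} => |D.β j|) ⟨0, ?_⟩ ⟨j, hj⟩
    rintro _ ⟨k, rfl⟩
    exact abs_nonneg _
  have hlt2 : |b j - D.β j| < |D.β j| := ((hbd j hj).trans_lt hlt).trans_le (hβ.trans hmin)
  rcases lt_trichotomy (D.β j) 0 with h | h | h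
  · rw [abs_of_neg h, abs_lt] at hlt2
    rw [sign_neg h, sign_neg (by linarith)]
  · rw [h, abs_zero] at hlt2
    exact absurd hlt2 (not_lt.2 (abs_nonneg _))
  · rw [abs_of_pos h, abs_lt] at hlt2
    rw [sign_pos h, sign_pos (by linarith)]

end MultData

/-! ### Sub-exponential random variables and Bernstein's inequality -/

section SubExponential

variable {Ω : Type*} [MeasurableSpace Ω] {P : Measure Ω}

/-- The exponential moment `E exp(|Y| / K)` is finite and at most `9`. -/
def HasExpMoment (P : Measure Ω) (Y : Ω → ℝ) (K : ℝ) : Prop :=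
  Integrable (fun ω => Real.exp (|Y ω| / K)) P ∧ ∫ ω, Real.exp (|Y ω| / K) ∂P ≤ 9

theorem HasExpMoment.neg {Y : Ω → ℝ} {K : ℝ} (h : HasExpMoment P Y K) :
    HasExpMoment P (fun ω => -Y ω) K := by
  simpa only [HasExpMoment, abs_neg] using h

theorem HasExpMoment.integrable {Y : Ω → ℝ} {K : ℝ} (h : HasExpMoment P Y K) (hY : Measurable Y)
    (hK : 0 < K) : Integrable Y P := by
  refine (h.1.const_mul K).mono' hY.aestronglyMeasurable (Eventually.of_forall fun ω => ?_)
  have h1 := Real.add_one_le_exp (|Y ω| / K)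
  rw [Real.norm_eq_abs]
  calc |Y ω| = K * (|Y ω| / K) := by field_simp
    _ ≤ _ := by gcongr; linarith

theorem HasExpMoment.integrable_exp_mul {Y : Ω → ℝ} {K l : ℝ} (h : HasExpMoment P Y K)
    (hY : Measurable Y) (hK : 0 < K) (hl : |l| ≤ 1 / (2 * K)) :
    Integrable (fun ω => Real.exp (l * Y ω)) P := by
  refine h.1.mono' (by fun_prop) (Eventually.of_forall fun ω => ?_)
  rw [Real.norm_of_nonneg (Real.exp_pos _).le]
  refine Real.exp_le_exp.2 ((le_abs_self _).trans ?_)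
  rw [abs_mul]
  calc |l| * |Y ω| ≤ 1 / K * |Y ω| := by
        gcongr
        refine hl.trans ?_
        gcongr
        linarith
    _ = |Y ω| / K := by ring

variable [IsProbabilityMeasure P]

theorem HasSubGaussianTail.lintegral_exp_sq_le {Y : Ω → ℝ} {τ : ℝ} (h : HasSubGaussianTail P Y τ)
    (hY : Measurable Y) (hτ : 0 < τ) :
    ∫⁻ ω, ENNReal.ofReal (Real.exp (Y ω ^ 2 / (4 * τ ^ 2))) ∂P ≤ 3 := by
  rw [lintegral_eq_lintegral_meas_lt P (Eventually.of_forall fun ω => (Real.exp_pos _).le)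
    (by fun_prop)]
  have hsub : Set.Ioi (0 : ℝ) = Set.Ioc 0 1 ∪ Set.Ioi 1 :=
    (Set.Ioc_union_Ioi_eq_Ioi zero_le_one).symm
  rw [hsub]
  refine (lintegral_union_le _ _ _).trans ?_
  have h1 : ∫⁻ t in Set.Ioc (0 : ℝ) 1, P {ω | t < Real.exp (Y ω ^ 2 / (4 * τ ^ 2))} ≤ 1 := by
    calc _ ≤ ∫⁻ _t in Set.Ioc (0 : ℝ) 1, 1 := lintegral_mono fun t => prob_le_one
      _ = 1 := by simp
  have h2 : ∫⁻ t in Set.Ioi (1 : ℝ), P {ω | t < Real.exp (Y ω ^ 2 / (4 * τ ^ 2))} ≤ 2 := by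
    calc _ ≤ ∫⁻ t in Set.Ioi (1 : ℝ), ENNReal.ofReal (2 * t ^ (-2 : ℝ)) := by
          refine setLIntegral_mono' measurableSet_Ioi fun t ht => ?_
          have ht1 : 1 < t := ht
          have hlog : 0 < Real.log t := Real.log_pos ht1
          have hpos : 0 < 2 * τ * Real.sqrt (Real.log t) := by positivity
          have hle := h _ hpos
          have hset : {ω | t < Real.exp (Y ω ^ 2 / (4 * τ ^ 2))} ⊆
              {ω | 2 * τ * Real.sqrt (Real.log t) < |Y ω|} := by
            intro ω hω
            simp only [Set.mem_ofPred_eq] at hω ⊢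
            rw [← Real.log_lt_iff_lt_exp (by linarith), lt_div_iff₀ (by positivity)] at hω
            refine lt_of_pow_lt_pow_left₀ 2 (abs_nonneg _) ?_
            rw [mul_pow, mul_pow, Real.sq_sqrt hlog.le, sq_abs]
            linarith
          refine (measure_mono hset).trans ?_
          rw [← ofReal_measureReal]
          refine ENNReal.ofReal_le_ofReal (hle.trans_eq ?_)
          rw [mul_pow, mul_pow, Real.sq_sqrt hlog.le, Real.rpow_def_of_pos (by linarith)]
          congr 2
          field_simp
      _ = ENNReal.ofReal (∫ t in Set.Ioi (1 : ℝ), 2 * t ^ (-2 : ℝ)) := by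
          rw [ofReal_integral_eq_lintegral_ofReal]
          · exact (integrableOn_Ioi_rpow_of_lt (by norm_num) zero_lt_one).const_mul 2
          · filter_upwards [ae_restrict_mem measurableSet_Ioi] with t ht
            have : (0 : ℝ) < t := zero_lt_one.trans ht
            positivity
      _ = 2 := by
          rw [integral_const_mul, integral_Ioi_rpow_of_lt (by norm_num) zero_lt_one]
          norm_num
  calc _ ≤ (1 : ENNReal) + 2 := add_le_add h1 h2
    _ = 3 := by norm_num

theorem HasSubGaussianTail.integrable_exp_sq {Y : Ω → ℝ} {τ : ℝ} (h : HasSubGaussianTail P Y τ)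
    (hY : Measurable Y) (hτ : 0 < τ) :
    Integrable (fun ω => Real.exp (Y ω ^ 2 / (4 * τ ^ 2))) P := by
  refine ⟨by fun_prop, ?_⟩
  rw [hasFiniteIntegral_iff_ofReal (Eventually.of_forall fun ω => (Real.exp_pos _).le)]
  exact (h.lintegral_exp_sq_le hY hτ).trans_lt (by norm_num)

theorem HasSubGaussianTail.integral_exp_sq_le {Y : Ω → ℝ} {τ : ℝ} (h : HasSubGaussianTail P Y τ)
    (hY : Measurable Y) (hτ : 0 < τ) :
    ∫ ω, Real.exp (Y ω ^ 2 / (4 * τ ^ 2)) ∂P ≤ 3 := by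
  rw [integral_eq_lintegral_of_nonneg_ae (Eventually.of_forall fun ω => (Real.exp_pos _).le)
    (by fun_prop)]
  exact ENNReal.toReal_le_of_le_ofReal (by norm_num)
    ((h.lintegral_exp_sq_le hY hτ).trans_eq (by norm_num))

theorem HasSubGaussianTail.memLp_two {Y : Ω → ℝ} {τ : ℝ} (h : HasSubGaussianTail P Y τ)
    (hY : Measurable Y) (hτ : 0 < τ) : MemLp Y 2 P := by
  rw [memLp_two_iff_integrable_sq hY.aestronglyMeasurable]
  refine ((h.integrable_exp_sq hY hτ).const_mul (4 * τ ^ 2)).mono' (by fun_prop)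
    (Eventually.of_forall fun ω => ?_)
  rw [Real.norm_of_nonneg (sq_nonneg _)]
  have h1 := Real.add_one_le_exp (Y ω ^ 2 / (4 * τ ^ 2))
  have h2 : Y ω ^ 2 = 4 * τ ^ 2 * (Y ω ^ 2 / (4 * τ ^ 2)) := by field_simp
  rw [h2]
  gcongr
  rw [← h2]
  linarith

theorem hasExpMoment_of_abs_le {U V Y : Ω → ℝ} {τ σ K : ℝ} (hU : Measurable U) (hV : Measurable V)
    (hY : Measurable Y) (hτ : 0 < τ) (hσ : 0 < σ) (hK : 0 < K)
    (hUt : HasSubGaussianTail P U τ) (hVt : HasSubGaussianTail P V σ)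
    (h : ∀ ω, |Y ω| ≤ K * (U ω ^ 2 / (8 * τ ^ 2) + V ω ^ 2 / (8 * σ ^ 2) + 1)) :
    HasExpMoment P Y K := by
  have hle : ∀ ω, Real.exp (|Y ω| / K) ≤ Real.exp 1 / 2 *
      (Real.exp (U ω ^ 2 / (4 * τ ^ 2)) + Real.exp (V ω ^ 2 / (4 * σ ^ 2))) := by
    intro ω
    have h1 : |Y ω| / K ≤ U ω ^ 2 / (8 * τ ^ 2) + V ω ^ 2 / (8 * σ ^ 2) + 1 := by
      rw [div_le_iff₀ hK, mul_comm]; exact h ω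
    refine (Real.exp_le_exp.2 h1).trans ?_
    rw [Real.exp_add, Real.exp_add]
    have e1 : Real.exp (U ω ^ 2 / (4 * τ ^ 2)) = Real.exp (U ω ^ 2 / (8 * τ ^ 2)) ^ 2 := by
      rw [← Real.exp_nat_mul]; congr 1; push_cast; field_simp; ring
    have e2 : Real.exp (V ω ^ 2 / (4 * σ ^ 2)) = Real.exp (V ω ^ 2 / (8 * σ ^ 2)) ^ 2 := by
      rw [← Real.exp_nat_mul]; congr 1; push_cast; field_simp; ring
    rw [e1, e2]
    have := two_mul_le_add_sq (Real.exp (U ω ^ 2 / (8 * τ ^ 2))) (Real.exp (V ω ^ 2 / (8 * σ ^ 2)))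
    nlinarith [Real.exp_pos 1]
  have hint : Integrable (fun ω => Real.exp 1 / 2 *
      (Real.exp (U ω ^ 2 / (4 * τ ^ 2)) + Real.exp (V ω ^ 2 / (4 * σ ^ 2)))) P :=
    ((hUt.integrable_exp_sq hU hτ).add (hVt.integrable_exp_sq hV hσ)).const_mul _
  have hint2 : Integrable (fun ω => Real.exp (|Y ω| / K)) P := by
    refine hint.mono' ?_ (Eventually.of_forall fun ω => ?_)
    · exact (Real.measurable_exp.comp ((measurable_norm.comp hY).div_const K)).aestronglyMeasurable
    · rw [Real.norm_of_nonneg (Real.exp_pos _).le]; exact hle ω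
  refine ⟨hint2, (integral_mono hint2 hint hle).trans ?_⟩
  rw [integral_const_mul, integral_add (hUt.integrable_exp_sq hU hτ) (hVt.integrable_exp_sq hV hσ)]
  have h1 := hUt.integral_exp_sq_le hU hτ
  have h2 := hVt.integral_exp_sq_le hV hσ
  have h3 := Real.exp_one_lt_d9
  have h4 := Real.exp_pos 1
  nlinarith

theorem exp_le_one_add_self_add_sq_mul_exp_abs (x : ℝ) :
    Real.exp x ≤ 1 + x + x ^ 2 * Real.exp |x| := by
  have h := Complex.norm_exp_sub_sum_le_norm_mul_exp (x : ℂ) 2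
  have e : Complex.exp (x : ℂ) - ∑ m ∈ Finset.range 2, (x : ℂ) ^ m / (m.factorial : ℂ) =
      ((Real.exp x - (1 + x) : ℝ) : ℂ) := by
    simp [Finset.sum_range_succ]
  rw [e, Complex.norm_real, Complex.norm_real, Real.norm_eq_abs, Real.norm_eq_abs, sq_abs] at h
  linarith [le_abs_self (Real.exp x - (1 + x))]

theorem HasExpMoment.mgf_le {Y : Ω → ℝ} {K l : ℝ} (h : HasExpMoment P Y K) (hY : Measurable Y)
    (hK : 0 < K) (hmean : ∫ ω, Y ω ∂P = 0) (hl : |l| ≤ 1 / (2 * K)) :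
    mgf Y P l ≤ Real.exp (72 * K ^ 2 * l ^ 2) := by
  have hpt : ∀ ω, Real.exp (l * Y ω) ≤
      1 + l * Y ω + 8 * K ^ 2 * l ^ 2 * Real.exp (|Y ω| / K) := by
    intro ω
    refine (exp_le_one_add_self_add_sq_mul_exp_abs _).trans ?_
    set u := |Y ω| / (2 * K) with hu
    have hu0 : 0 ≤ u := by positivity
    have h1 : |l * Y ω| ≤ u := by
      rw [abs_mul]
      calc |l| * |Y ω| ≤ 1 / (2 * K) * |Y ω| := by gcongr
        _ = u := by rw [hu]; ring
    have h2 : Real.exp (|Y ω| / K) = Real.exp u * Real.exp u := by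
      rw [← Real.exp_add]; congr 1; rw [hu]; field_simp; norm_num
    have h3 : Y ω ^ 2 = 4 * K ^ 2 * u ^ 2 := by
      rw [hu, div_pow, sq_abs]; field_simp; norm_num
    have h4 : u ^ 2 ≤ 2 * Real.exp u := by
      have := Real.quadratic_le_exp_of_nonneg hu0
      nlinarith
    have h5 : (l * Y ω) ^ 2 * Real.exp |l * Y ω| ≤
        8 * K ^ 2 * l ^ 2 * (Real.exp u * Real.exp u) := by
      rw [mul_pow, h3]
      calc l ^ 2 * (4 * K ^ 2 * u ^ 2) * Real.exp |l * Y ω|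
          ≤ l ^ 2 * (4 * K ^ 2 * (2 * Real.exp u)) * Real.exp u := by gcongr
        _ = _ := by ring
    rw [h2]
    linarith
  have hiY := h.integrable hY hK
  have hi1 : Integrable (fun ω => 1 + l * Y ω) P := (integrable_const _).add (hiY.const_mul l)
  have hi2 : Integrable (fun ω => 8 * K ^ 2 * l ^ 2 * Real.exp (|Y ω| / K)) P := h.1.const_mul _
  have h1 : mgf Y P l ≤ 1 + 72 * K ^ 2 * l ^ 2 := by
    refine (integral_mono (h.integrable_exp_mul hY hK hl) (hi1.add hi2) hpt).trans ?_
    simp only [Pi.add_apply]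
    rw [integral_add hi1 hi2, integral_add (integrable_const _) (hiY.const_mul l),
      integral_const_mul, integral_const_mul, hmean]
    have := mul_le_mul_of_nonneg_left h.2 (show 0 ≤ 8 * K ^ 2 * l ^ 2 by positivity)
    simp
    linarith
  exact h1.trans (by linarith [Real.add_one_le_exp (72 * K ^ 2 * l ^ 2)])

theorem measure_ge_average_le {n : ℕ} {Y : Fin n → Ω → ℝ} {K t : ℝ} (hind : iIndepFun Y P)
    (hY : ∀ i, Measurable (Y i)) (hK : 0 < K) (hmean : ∀ i, ∫ ω, Y i ω ∂P = 0)
    (hm : ∀ i, HasExpMoment P (Y i) K) (ht : 0 < t) (htK : t ≤ 72 * K) :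
    P.real {ω | t ≤ (n : ℝ)⁻¹ * ∑ i, Y i ω} ≤ Real.exp (-(n * t ^ 2 / (288 * K ^ 2))) := by
  rcases Nat.eq_zero_or_pos n with rfl | hn
  · simp [measureReal_le_one]
  have hn' : (0 : ℝ) < n := by exact_mod_cast hn
  set l := t / (144 * K ^ 2) with hl
  have hl0 : 0 ≤ l := by positivity
  have hlK : |l| ≤ 1 / (2 * K) := by
    rw [abs_of_nonneg hl0, hl, div_le_div_iff₀ (by positivity) (by positivity)]
    nlinarith
  have hset : {ω | t ≤ (n : ℝ)⁻¹ * ∑ i, Y i ω} = {ω | n * t ≤ (∑ i, Y i) ω} := by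
    ext ω
    simp only [Set.mem_ofPred_eq, Finset.sum_apply]
    rw [inv_mul_eq_div, le_div_iff₀ hn', mul_comm]
  rw [hset]
  refine (measure_ge_le_exp_mul_mgf (n * t) hl0
    (hind.integrable_exp_mul_sum hY fun i _ => (hm i).integrable_exp_mul (hY i) hK hlK)).trans ?_
  rw [hind.mgf_sum hY]
  have h1 : ∏ i, mgf (Y i) P l ≤ ∏ _i : Fin n, Real.exp (72 * K ^ 2 * l ^ 2) :=
    Finset.prod_le_prod (fun i _ => mgf_nonneg)
      fun i _ => (hm i).mgf_le (hY i) hK (hmean i) hlK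
  rw [Finset.prod_const, Finset.card_univ, Fintype.card_fin, ← Real.exp_nat_mul] at h1
  refine (mul_le_mul_of_nonneg_left h1 (Real.exp_pos _).le).trans_eq ?_
  rw [← Real.exp_add]
  congr 1
  rw [hl]
  field_simp
  ring

/-- Bernstein's inequality for averages of independent centered sub-exponential variables. -/
theorem measure_ge_abs_average_le {n : ℕ} {Y : Fin n → Ω → ℝ} {K t : ℝ} (hind : iIndepFun Y P)
    (hY : ∀ i, Measurable (Y i)) (hK : 0 < K) (hmean : ∀ i, ∫ ω, Y i ω ∂P = 0)
    (hm : ∀ i, HasExpMoment P (Y i) K) (ht : 0 < t) (htK : t ≤ 72 * K) :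
    P.real {ω | t ≤ |(n : ℝ)⁻¹ * ∑ i, Y i ω|} ≤ 2 * Real.exp (-(n * t ^ 2 / (288 * K ^ 2))) := by
  have h1 := measure_ge_average_le hind hY hK hmean hm ht htK
  have h2 := measure_ge_average_le (Y := fun i ω => -Y i ω)
    (hind.comp (fun _ x => -x) fun _ => measurable_neg) (fun i => (hY i).neg) hK
    (fun i => by rw [integral_neg, hmean i, neg_zero]) (fun i => (hm i).neg) ht htK
  have hsub : {ω | t ≤ |(n : ℝ)⁻¹ * ∑ i, Y i ω|} ⊆
      {ω | t ≤ (n : ℝ)⁻¹ * ∑ i, Y i ω} ∪ {ω | t ≤ (n : ℝ)⁻¹ * ∑ i, -Y i ω} := by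
    intro ω hω
    simp only [Set.mem_union, Set.mem_ofPred_eq, Finset.sum_neg_distrib, mul_neg] at hω ⊢
    exact le_abs.1 hω
  have h3 := (measureReal_mono hsub (by finiteness)).trans (measureReal_union_le (μ := P) _ _)
  linarith

/-- Bernstein's inequality without restriction on the deviation. -/
theorem measure_ge_abs_average_le_add {n : ℕ} {Y : Fin n → Ω → ℝ} {K t : ℝ}
    (hind : iIndepFun Y P) (hY : ∀ i, Measurable (Y i)) (hK : 0 < K)
    (hmean : ∀ i, ∫ ω, Y i ω ∂P = 0) (hm : ∀ i, HasExpMoment P (Y i) K) (ht : 0 < t) :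
    P.real {ω | t ≤ |(n : ℝ)⁻¹ * ∑ i, Y i ω|} ≤
      2 * Real.exp (-(n * t ^ 2 / (288 * K ^ 2))) + 2 * Real.exp (-(n / 288)) := by
  rcases le_total t K with h | h
  · have := measure_ge_abs_average_le hind hY hK hmean hm ht (by linarith)
    linarith [Real.exp_pos (-((n : ℝ) / 288))]
  · have h1 := measure_ge_abs_average_le hind hY hK hmean hm hK (by linarith)
    have h2 : P.real {ω | t ≤ |(n : ℝ)⁻¹ * ∑ i, Y i ω|} ≤
        P.real {ω | K ≤ |(n : ℝ)⁻¹ * ∑ i, Y i ω|} :=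
      measureReal_mono (fun ω hω => h.trans hω) (by finiteness)
    have h3 : n * K ^ 2 / (288 * K ^ 2) = (n : ℝ) / 288 := by field_simp
    rw [h3] at h1
    linarith [Real.exp_pos (-(n * t ^ 2 / (288 * K ^ 2)))]

end SubExponential

/-! ### Independence of families -/

section Independence

variable {Ω : Type*} [MeasurableSpace Ω] {P : Measure Ω} [IsProbabilityMeasure P]

theorem iIndepFun_prodMk {ι α β : Type*} [Fintype ι] [MeasurableSpace α] [MeasurableSpace β]
    {f : ι → Ω → α} {g : ι → Ω → β} (hf : ∀ i, Measurable (f i)) (hg : ∀ i, Measurable (g i))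
    (hfi : iIndepFun f P) (hgi : iIndepFun g P)
    (hfg : IndepFun (fun ω i => f i ω) (fun ω i => g i ω) P) :
    iIndepFun (fun i ω => (f i ω, g i ω)) P := by
  have hpf : ∀ i, IsProbabilityMeasure (P.map (f i)) :=
    fun i => Measure.isProbabilityMeasure_map (hf i).aemeasurable
  have hpg : ∀ i, IsProbabilityMeasure (P.map (g i)) :=
    fun i => Measure.isProbabilityMeasure_map (hg i).aemeasurable
  rw [iIndepFun_iff_map_fun_eq_pi_map (fun i => ((hf i).prodMk (hg i)).aemeasurable)]
  have h1 : ∀ i, P.map (fun ω => (f i ω, g i ω)) = (P.map (f i)).prod (P.map (g i)) := fun i =>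
    (indepFun_iff_map_prod_eq_prod_map_map (hf i).aemeasurable (hg i).aemeasurable).1
      (hfg.comp (measurable_pi_apply i) (measurable_pi_apply i))
  simp_rw [h1]
  have hmp := measurePreserving_arrowProdEquivProdArrow α β ι (fun i => P.map (f i))
    (fun i => P.map (g i))
  rw [← (MeasurableEquiv.arrowProdEquivProdArrow α β ι).map_measurableEquiv_injective.eq_iff,
    hmp.map_eq, Measure.map_map (MeasurableEquiv.measurable _)
      (measurable_pi_iff.2 fun i => (hf i).prodMk (hg i)),
    ← hfi.map_fun_eq_pi_map (fun i => (hf i).aemeasurable),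
    ← hgi.map_fun_eq_pi_map (fun i => (hg i).aemeasurable),
    ← (indepFun_iff_map_prod_eq_prod_map_map (measurable_pi_iff.2 hf).aemeasurable
      (measurable_pi_iff.2 hg).aemeasurable).1 hfg]
  rfl

theorem iIndepFun_rows {ι κ α : Type*} [Finite ι] [Finite κ] [MeasurableSpace α]
    {f : ι → κ → Ω → α} (hf : ∀ i j, Measurable (f i j))
    (h : iIndepFun (fun (ij : ι × κ) ω => f ij.1 ij.2 ω) P) :
    iIndepFun (fun i ω j => f i j ω) P := by
  have hp : ∀ i j, IsProbabilityMeasure (P.map (f i j)) :=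
    fun i j => Measure.isProbabilityMeasure_map (hf i j).aemeasurable
  have hrow : ∀ i, iIndepFun (f i) P := fun i =>
    h.precomp (g := fun j => (i, j)) fun _ _ h => (Prod.mk.inj h).2
  have hsig : iIndepFun (fun (q : (_ : ι) × κ) ω => f q.1 q.2 ω) P :=
    h.precomp (Equiv.sigmaEquivProd ι κ).injective
  have hm : ∀ i, Measurable (fun ω j => f i j ω) := fun i => measurable_pi_iff.2 (hf i)
  have hmsig : Measurable fun ω (q : (_ : ι) × κ) => f q.1 q.2 ω :=
    measurable_pi_iff.2 fun q => hf q.1 q.2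
  have hsig' := (iIndepFun_iff_map_fun_eq_infinitePi_map
    (X := fun (q : (_ : ι) × κ) ω => f q.1 q.2 ω) fun q => hf q.1 q.2).1 hsig
  have hcomp : (MeasurableEquiv.piCurry fun (_ : ι) (_ : κ) => α) ∘
      (fun ω (q : (_ : ι) × κ) => f q.1 q.2 ω) = fun ω i j => f i j ω := by
    ext; simp [Sigma.curry]
  rw [iIndepFun_iff_map_fun_eq_infinitePi_map hm, ← hcomp,
    ← Measure.map_map (MeasurableEquiv.measurable _) hmsig,
    hsig',
    Measure.infinitePi_map_piCurry (fun i j => P.map (f i j))]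
  congr 1
  funext i
  exact ((iIndepFun_iff_map_fun_eq_infinitePi_map (hf i)).1 (hrow i)).symm

end Independence

/-! ### Closeness of the surrogates to their targets -/

/-- `Z` has the tails of an average of `n` independent sub-exponential variables of scale `K`. -/
def HasBernsteinTail {Ω : Type*} [MeasurableSpace Ω] (P : Measure Ω) (n : ℕ) (Z : Ω → ℝ)
    (K : ℝ) : Prop :=
  (∀ t, 0 < t → t ≤ K → P.real {ω | t ≤ |Z ω|} ≤ 2 * Real.exp (-(n * t ^ 2 / (288 * K ^ 2)))) ∧
  ∀ t, 0 < t → P.real {ω | t ≤ |Z ω|} ≤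
    2 * Real.exp (-(n * t ^ 2 / (288 * K ^ 2))) + 2 * Real.exp (-(n / 288))

theorem hasBernsteinTail_average {Ω : Type*} [MeasurableSpace Ω] {P : Measure Ω}
    [IsProbabilityMeasure P] {n : ℕ} {Y : Fin n → Ω → ℝ} {Z : Ω → ℝ} {K : ℝ}
    (hZ : ∀ ω, Z ω = (n : ℝ)⁻¹ * ∑ i, Y i ω) (hind : iIndepFun Y P)
    (hY : ∀ i, Measurable (Y i)) (hK : 0 < K) (hmean : ∀ i, ∫ ω, Y i ω ∂P = 0)
    (hm : ∀ i, HasExpMoment P (Y i) K) : HasBernsteinTail P n Z K := by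
  simp only [HasBernsteinTail, hZ]
  exact ⟨fun t ht htK => measure_ge_abs_average_le hind hY hK hmean hm ht (by linarith),
    fun t ht => measure_ge_abs_average_le_add hind hY hK hmean hm ht⟩

/-- The scale of the sub-exponential variables occurring in the model. -/
noncomputable def MultParams.scale (θ : MultParams) : ℝ :=
  1 + θ.Xmax ^ 2 * (8 * θ.τ ^ 2 + 2 * θ.μmax ^ 2) / |θ.Mmin| + θ.Xmax ^ 2 +
    8 * (|θ.Xmax| / |θ.μmin|) * (|θ.σ| + |θ.Xmax|) * |θ.τ| + 2 * |θ.Xmax| * |θ.σ|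

theorem MultParams.one_le_scale (θ : MultParams) : 1 ≤ θ.scale := by
  unfold scale
  have h1 : 0 ≤ θ.Xmax ^ 2 * (8 * θ.τ ^ 2 + 2 * θ.μmax ^ 2) / |θ.Mmin| := by positivity
  have h2 : 0 ≤ 8 * (|θ.Xmax| / |θ.μmin|) * (|θ.σ| + |θ.Xmax|) * |θ.τ| := by positivity
  have h3 : 0 ≤ 2 * |θ.Xmax| * |θ.σ| := by positivity
  have h4 : 0 ≤ θ.Xmax ^ 2 := by positivity
  linarith

theorem MultParams.scale_pos (θ : MultParams) : 0 < θ.scale := zero_lt_one.trans_le θ.one_le_scale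

namespace MultData

variable {n p : ℕ} {Ω : Type*} {D : MultData n p Ω} [MeasurableSpace Ω] {P : Measure Ω}
  {θ : MultParams}

theorem IsMultModel.hasSubGaussianTail_entry (hM : D.IsMultModel P θ) (i : Fin n) (j : Fin p) :
    HasSubGaussianTail P (fun ω => D.M i ω j - D.μM j) θ.τ := by
  have h := hM.M_subGaussian i (Pi.single j 1) (by
    rw [Finset.sum_eq_single j] <;> simp +contextual)
  convert h using 2 with ω
  rw [Finset.sum_eq_single j]
  · simp [hM.M_mean]
  · intro k _ hk; simp [hk]
  · simp

theorem IsMultModel.measurable_entry (hM : D.IsMultModel P θ) (i : Fin n) (j : Fin p) :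
    Measurable (fun ω => D.M i ω j) := measurable_pi_iff.1 (hM.M_measurable i) j

theorem IsMultModel.abs_μM_le (hM : D.IsMultModel P θ) (j : Fin p) : |D.μM j| ≤ θ.μmax := by
  rw [abs_of_pos (hM.μmin_pos.trans_le (hM.μmin_le j))]
  exact hM.le_μmax j

theorem abs_mulVec_beta_le {σ Xmax : ℝ} (hR : D.IsRegression P σ Xmax) (i : Fin n) :
    |D.X.mulVec D.β i| ≤ D.s * Xmax * D.B := by
  have h1 : D.X.mulVec D.β i = ∑ k ∈ D.S, D.X i k * D.β k :=
    (Finset.sum_subset (Finset.subset_univ D.S) fun k _ hk => by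
      rw [D.beta_eq_zero hk, mul_zero]).symm
  rw [h1]
  refine (Finset.abs_sum_le_sum_abs _ _).trans ?_
  calc ∑ k ∈ D.S, |D.X i k * D.β k| ≤ ∑ _k ∈ D.S, Xmax * D.B := by
        refine Finset.sum_le_sum fun k _ => ?_
        rw [abs_mul]
        exact mul_le_mul (hR.bounded i k) (D.abs_beta_le k) (abs_nonneg _)
          ((abs_nonneg _).trans (hR.bounded i k))
    _ = D.s * Xmax * D.B := by rw [Finset.sum_const, nsmul_eq_mul]; unfold s; ring

variable [IsProbabilityMeasure P]

theorem IsMultModel.memLp_entry (hM : D.IsMultModel P θ) (i : Fin n) (j : Fin p) :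
    MemLp (fun ω => D.M i ω j) 2 P := by
  have h := ((hM.hasSubGaussianTail_entry i j).memLp_two
    ((hM.measurable_entry i j).sub_const _) hM.τ_pos).add (memLp_const (D.μM j))
  simpa [Pi.add_def] using h

theorem IsMultModel.integral_entry_mul_entry (hM : D.IsMultModel P θ) (i : Fin n) (j k : Fin p) :
    ∫ ω, D.M i ω j * D.M i ω k ∂P = D.covM j k + D.μM j * D.μM k := by
  have h := covariance_eq_sub (hM.memLp_entry i j) (hM.memLp_entry i k)
  rw [hM.M_cov, hM.M_mean, hM.M_mean] at h
  simp only [Pi.mul_apply] at h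
  linarith

theorem IsMultModel.hasBernsteinTail_SigHat (hM : D.IsMultModel P θ) (j k : Fin p) :
    HasBernsteinTail P n (fun ω => D.SigHat ω j k - D.Sig j k) θ.scale := by
  set E := D.covM j k + D.μM j * D.μM k with hE
  have hE0 : 0 < E := hM.Mmin_pos.trans_le (hM.Mmin_le j k)
  have hτ := hM.τ_pos
  have hmeas : ∀ i, Measurable fun m : Fin p → ℝ => D.X i j * D.X i k * (m j * m k / E - 1) :=
    fun i => by fun_prop
  refine hasBernsteinTail_average (Y := fun i ω => D.X i j * D.X i k *
    (D.M i ω j * D.M i ω k / E - 1)) (fun ω => ?_) (hM.M_indep.comp _ hmeas)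
    (fun i => (hmeas i).comp (hM.M_measurable i)) θ.scale_pos (fun i => ?_) (fun i => ?_)
  · simp only [SigHat, Sig, Z, Matrix.of_apply, Matrix.smul_apply, Matrix.mul_apply,
      Matrix.transpose_apply, smul_eq_mul, ← hE]
    rw [mul_div_assoc, ← mul_sub, Finset.sum_div, ← Finset.sum_sub_distrib]
    congr 1
    exact Finset.sum_congr rfl fun i _ => by ring
  · have hint : Integrable (fun ω => D.M i ω j * D.M i ω k) P :=
      (hM.memLp_entry i j).integrable_mul (hM.memLp_entry i k)
    rw [integral_const_mul, integral_sub (hint.div_const E) (integrable_const _), integral_div,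
      hM.integral_entry_mul_entry, ← hE, div_self hE0.ne']
    simp
  · refine hasExpMoment_of_abs_le ((hM.measurable_entry i j).sub_const (D.μM j))
      ((hM.measurable_entry i k).sub_const (D.μM k)) ((hmeas i).comp (hM.M_measurable i)) hτ hτ
      θ.scale_pos (hM.hasSubGaussianTail_entry i j) (hM.hasSubGaussianTail_entry i k)
      (fun ω => ?_)
    set a := D.M i ω j - D.μM j with ha
    set b := D.M i ω k - D.μM k with hb
    have e1 : |D.M i ω j * D.M i ω k| ≤ a ^ 2 + b ^ 2 + 2 * θ.μmax ^ 2 := by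
      have f1 : |D.M i ω j| ≤ |a| + θ.μmax := by
        calc |D.M i ω j| = |a + D.μM j| := by rw [ha]; ring_nf
          _ ≤ _ := (abs_add_le _ _).trans (by linarith [hM.abs_μM_le j])
      have f2 : |D.M i ω k| ≤ |b| + θ.μmax := by
        calc |D.M i ω k| = |b + D.μM k| := by rw [hb]; ring_nf
          _ ≤ _ := (abs_add_le _ _).trans (by linarith [hM.abs_μM_le k])
      rw [abs_mul, ← sq_abs a, ← sq_abs b]
      have f3 := mul_le_mul f1 f2 (abs_nonneg _) ((abs_nonneg _).trans f1)
      nlinarith [sq_nonneg (|a| - |b|), sq_nonneg (|a| + |b| - θ.μmax),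
        sq_nonneg (|a| - θ.μmax), sq_nonneg (|b| - θ.μmax)]
    have e2 : |D.M i ω j * D.M i ω k / E - 1| ≤
        (a ^ 2 + b ^ 2 + 2 * θ.μmax ^ 2) / θ.Mmin + 1 := by
      refine (abs_sub _ _).trans ?_
      rw [abs_one, abs_div, abs_of_pos hE0]
      gcongr
      · exact hM.Mmin_pos
      · exact hM.Mmin_le j k
    have e3 : |D.X i j * D.X i k| ≤ θ.Xmax ^ 2 := by
      rw [abs_mul, sq]
      exact mul_le_mul (hM.regression.bounded i j) (hM.regression.bounded i k) (abs_nonneg _)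
        ((abs_nonneg _).trans (hM.regression.bounded i j))
    have hK : θ.Xmax ^ 2 * (8 * θ.τ ^ 2 + 2 * θ.μmax ^ 2) / θ.Mmin + θ.Xmax ^ 2 ≤ θ.scale := by
      unfold MultParams.scale
      have h2 : 0 ≤ 8 * (|θ.Xmax| / |θ.μmin|) * (|θ.σ| + |θ.Xmax|) * |θ.τ| := by positivity
      have h3 : 0 ≤ 2 * |θ.Xmax| * |θ.σ| := by positivity
      rw [abs_of_pos hM.Mmin_pos]
      linarith
    have hMm := hM.Mmin_pos
    calc |D.X i j * D.X i k * (D.M i ω j * D.M i ω k / E - 1)|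
        ≤ θ.Xmax ^ 2 * ((a ^ 2 + b ^ 2 + 2 * θ.μmax ^ 2) / θ.Mmin + 1) := by
          rw [abs_mul]; gcongr
      _ ≤ (θ.Xmax ^ 2 * (8 * θ.τ ^ 2 + 2 * θ.μmax ^ 2) / θ.Mmin + θ.Xmax ^ 2) *
          (a ^ 2 / (8 * θ.τ ^ 2) + b ^ 2 / (8 * θ.τ ^ 2) + 1) := by
          have f1 : 0 ≤ θ.Xmax ^ 2 * (8 * θ.τ ^ 2) / θ.Mmin := by positivity
          have f2 : 0 ≤ θ.Xmax ^ 2 * (2 * θ.μmax ^ 2) / θ.Mmin + θ.Xmax ^ 2 := by positivity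
          have f3 : 0 ≤ a ^ 2 / (8 * θ.τ ^ 2) + b ^ 2 / (8 * θ.τ ^ 2) := by positivity
          have f4 : θ.Xmax ^ 2 * ((a ^ 2 + b ^ 2 + 2 * θ.μmax ^ 2) / θ.Mmin + 1) =
              θ.Xmax ^ 2 * (8 * θ.τ ^ 2) / θ.Mmin *
                (a ^ 2 / (8 * θ.τ ^ 2) + b ^ 2 / (8 * θ.τ ^ 2)) +
              (θ.Xmax ^ 2 * (2 * θ.μmax ^ 2) / θ.Mmin + θ.Xmax ^ 2) := by
            field_simp
            ring
          have f5 : θ.Xmax ^ 2 * (8 * θ.τ ^ 2 + 2 * θ.μmax ^ 2) / θ.Mmin + θ.Xmax ^ 2 =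
              θ.Xmax ^ 2 * (8 * θ.τ ^ 2) / θ.Mmin +
              (θ.Xmax ^ 2 * (2 * θ.μmax ^ 2) / θ.Mmin + θ.Xmax ^ 2) := by ring
          rw [f4, f5]
          have f6 := mul_nonneg f2 f3
          linarith
      _ ≤ _ := by gcongr

theorem IsMultModel.hasBernsteinTail_rhoTilde (hM : D.IsMultModel P θ) (hs : 1 ≤ D.s)
    (j : Fin p) :
    HasBernsteinTail P n (fun ω => D.rhoTilde ω j - D.rho ω j) (D.s * (1 + D.B) * θ.scale) := by
  have hτ := hM.τ_pos
  have hσ := hM.regression.σ_pos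
  have hμ : 0 < D.μM j := hM.μmin_pos.trans_le (hM.μmin_le j)
  have hB := D.B_nonneg
  have hK0 := θ.scale_pos
  have hmeas : ∀ i, Measurable fun q : (Fin p → ℝ) × ℝ =>
      D.X i j * ((D.X.mulVec D.β i + q.2) * (q.1 j / D.μM j - 1)) := fun i => by fun_prop
  have hpair : ∀ i, Measurable fun ω => (D.M i ω, D.w i ω) := fun i =>
    (hM.M_measurable i).prodMk (hM.regression.w_measurable i)
  have hK' : 0 < D.s * (1 + D.B) * θ.scale := by positivity
  refine hasBernsteinTail_average (Y := fun i ω => D.X i j * ((D.X.mulVec D.β i + D.w i ω) *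
    (D.M i ω j / D.μM j - 1))) (fun ω => ?_)
    ((iIndepFun_prodMk hM.M_measurable hM.regression.w_measurable hM.M_indep
      hM.regression.w_indep hM.M_indep_w).comp _ hmeas)
    (fun i => (hmeas i).comp (hpair i)) hK' (fun i => ?_) (fun i => ?_)
  · simp only [rhoTilde, rho, Z, y, Matrix.mulVec, dotProduct, Matrix.transpose_apply,
      Matrix.of_apply, Pi.smul_apply, smul_eq_mul]
    rw [mul_div_assoc, ← mul_sub, Finset.sum_div, ← Finset.sum_sub_distrib]
    congr 1
    exact Finset.sum_congr rfl fun i _ => by ring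
  · have hind : IndepFun (fun ω => D.X.mulVec D.β i + D.w i ω)
        (fun ω => D.M i ω j / D.μM j - 1) P := by
      have := hM.M_indep_w.symm.comp
        (φ := fun w : Fin n → ℝ => D.X.mulVec D.β i + w i)
        (ψ := fun m : Fin n → Fin p → ℝ => m i j / D.μM j - 1) (by fun_prop) (by fun_prop)
      exact this
    have hmw : AEStronglyMeasurable (fun ω => D.X.mulVec D.β i + D.w i ω) P :=
      ((hM.regression.w_measurable i).const_add _).aestronglyMeasurable
    have hmm : AEStronglyMeasurable (fun ω => D.M i ω j / D.μM j - 1) P :=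
      (((hM.measurable_entry i j).div_const _).sub_const _).aestronglyMeasurable
    have hint : Integrable (fun ω => D.M i ω j) P :=
      (hM.memLp_entry i j).integrable (by norm_num)
    rw [integral_const_mul, hind.integral_fun_mul_eq_mul_integral hmw hmm,
      integral_sub (hint.div_const _) (integrable_const _), integral_div, hM.M_mean,
      div_self hμ.ne']
    simp
  · refine hasExpMoment_of_abs_le ((hM.measurable_entry i j).sub_const (D.μM j))
      (hM.regression.w_measurable i) ((hmeas i).comp (hpair i)) hτ hσ
      hK' (hM.hasSubGaussianTail_entry i j) (hM.regression.w_subGaussian i)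
      (fun ω => ?_)
    set a := D.M i ω j - D.μM j with ha
    have hX := hM.regression.bounded i j
    have hX0 : 0 ≤ θ.Xmax := (abs_nonneg _).trans hX
    have hμm := hM.μmin_pos
    have e1 : |D.M i ω j / D.μM j - 1| ≤ |a| / θ.μmin := by
      have : D.M i ω j / D.μM j - 1 = a / D.μM j := by rw [ha]; field_simp
      rw [this, abs_div, abs_of_pos hμ]
      gcongr
      exact hM.μmin_le j
    have e2 : |D.X.mulVec D.β i + D.w i ω| ≤ D.s * θ.Xmax * D.B + |D.w i ω| :=
      (abs_add_le _ _).trans (by linarith [abs_mulVec_beta_le hM.regression i])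
    set u := |a| / θ.τ with hu
    set v := |D.w i ω| / θ.σ with hv
    have hu0 : 0 ≤ u := by positivity
    have hv0 : 0 ≤ v := by positivity
    have eu : a ^ 2 / (8 * θ.τ ^ 2) = u ^ 2 / 8 := by
      rw [hu, div_pow, sq_abs]; field_simp
    have ev : D.w i ω ^ 2 / (8 * θ.σ ^ 2) = v ^ 2 / 8 := by
      rw [hv, div_pow, sq_abs]; field_simp
    have ea : |a| = θ.τ * u := by rw [hu]; field_simp
    have ew : |D.w i ω| = θ.σ * v := by rw [hv]; field_simp
    rw [eu, ev]
    have hK : 8 * (θ.Xmax / θ.μmin) * (θ.σ + θ.Xmax) * θ.τ ≤ θ.scale := by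
      unfold MultParams.scale
      have h1 : 0 ≤ θ.Xmax ^ 2 * (8 * θ.τ ^ 2 + 2 * θ.μmax ^ 2) / |θ.Mmin| := by positivity
      have h3 : 0 ≤ 2 * |θ.Xmax| * |θ.σ| := by positivity
      rw [abs_of_pos hμm, abs_of_nonneg hX0, abs_of_pos hσ, abs_of_pos hτ] at *
      nlinarith
    have e4 : D.s * θ.Xmax * D.B + |D.w i ω| ≤
        D.s * (1 + D.B) * (θ.σ + θ.Xmax) * (1 + v) := by
      rw [ew]
      have g1 : 0 ≤ D.s * θ.Xmax := by positivity
      have g2 : 0 ≤ θ.σ * v := by positivity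
      have g3 : θ.σ * v ≤ D.s * (θ.σ * v) := le_mul_of_one_le_left g2 hs
      have g4 : 0 ≤ D.s * D.B * θ.σ := by positivity
      have g5 : 0 ≤ D.s * D.B * (θ.σ + θ.Xmax) * v := by positivity
      have g6 : 0 ≤ D.s * θ.σ := by positivity
      have g7 : 0 ≤ D.s * θ.Xmax * v := by positivity
      linarith
    calc |D.X i j * ((D.X.mulVec D.β i + D.w i ω) * (D.M i ω j / D.μM j - 1))|
        ≤ θ.Xmax * ((D.s * (1 + D.B) * (θ.σ + θ.Xmax) * (1 + v)) * (θ.τ * u / θ.μmin)) := by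
          rw [abs_mul, abs_mul, ← ea]
          gcongr
          exact e2.trans e4
      _ = D.s * (1 + D.B) * (8 * (θ.Xmax / θ.μmin) * (θ.σ + θ.Xmax) * θ.τ) *
          ((1 + v) * u / 8) := by ring
      _ ≤ D.s * (1 + D.B) * θ.scale * (u ^ 2 / 8 + v ^ 2 / 8 + 1) := by
          have : (1 + v) * u / 8 ≤ u ^ 2 / 8 + v ^ 2 / 8 + 1 := by
            nlinarith [sq_nonneg (u - 1), sq_nonneg (u - v), sq_nonneg v]
          gcongr

theorem IsMultModel.hasBernsteinTail_noiseCorr (hM : D.IsMultModel P θ) (hs : 1 ≤ D.s)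
    (j : Fin p) :
    HasBernsteinTail P n (fun ω => D.noiseCorr ω j) (D.s * (1 + D.B) * θ.scale) := by
  have hσ := hM.regression.σ_pos
  have hB := D.B_nonneg
  have hK0 := θ.scale_pos
  have hmeas : ∀ i, Measurable fun w : ℝ => D.X i j * w := fun i => by fun_prop
  have hK' : 0 < D.s * (1 + D.B) * θ.scale := by positivity
  refine hasBernsteinTail_average (Y := fun i ω => D.X i j * D.w i ω) (fun ω => rfl)
    (hM.regression.w_indep.comp _ hmeas) (fun i => (hmeas i).comp (hM.regression.w_measurable i))
    hK' (fun i => ?_) (fun i => ?_)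
  · rw [integral_const_mul, hM.regression.w_mean, mul_zero]
  · refine hasExpMoment_of_abs_le (hM.regression.w_measurable i) (hM.regression.w_measurable i)
      ((hmeas i).comp (hM.regression.w_measurable i)) hσ hσ hK' (hM.regression.w_subGaussian i)
      (hM.regression.w_subGaussian i) (fun ω => ?_)
    have hX := hM.regression.bounded i j
    have hX0 : 0 ≤ θ.Xmax := (abs_nonneg _).trans hX
    set v := |D.w i ω| / θ.σ with hv
    have hv0 : 0 ≤ v := by positivity
    have ev : D.w i ω ^ 2 / (8 * θ.σ ^ 2) = v ^ 2 / 8 := by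
      rw [hv, div_pow, sq_abs]; field_simp
    have ew : |D.w i ω| = θ.σ * v := by rw [hv]; field_simp
    have hK : 2 * θ.Xmax * θ.σ ≤ D.s * (1 + D.B) * θ.scale := by
      have h0 : 2 * θ.Xmax * θ.σ ≤ θ.scale := by
        unfold MultParams.scale
        have h1 : 0 ≤ θ.Xmax ^ 2 * (8 * θ.τ ^ 2 + 2 * θ.μmax ^ 2) / |θ.Mmin| := by positivity
        have h2 : 0 ≤ 8 * (|θ.Xmax| / |θ.μmin|) * (|θ.σ| + |θ.Xmax|) * |θ.τ| := by positivity
        rw [abs_of_nonneg hX0, abs_of_pos hσ] at *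
        nlinarith
      refine h0.trans (le_mul_of_one_le_left hK0.le ?_)
      nlinarith
    rw [ev]
    calc |D.X i j * D.w i ω| ≤ θ.Xmax * (θ.σ * v) := by
          rw [abs_mul, ew]; gcongr
      _ = 2 * θ.Xmax * θ.σ * (v / 2) := by ring
      _ ≤ D.s * (1 + D.B) * θ.scale * (v ^ 2 / 8 + v ^ 2 / 8 + 1) := by
          have : v / 2 ≤ v ^ 2 / 8 + v ^ 2 / 8 + 1 := by nlinarith [sq_nonneg (v - 1)]
          gcongr

end MultData

/-! ### Finite-sample probability bounds -/

theorem measureReal_not_forall_abs_le {Ω ι : Type*} [MeasurableSpace Ω] [Fintype ι]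
    {P : Measure Ω} [IsProbabilityMeasure P] {Z : ι → Ω → ℝ} {t q : ℝ}
    (h : ∀ i, P.real {ω | t ≤ |Z i ω|} ≤ q) :
    P.real {ω | ¬ ∀ i, |Z i ω| ≤ t} ≤ Fintype.card ι * q := by
  have hsub : {ω | ¬ ∀ i, |Z i ω| ≤ t} ⊆ ⋃ i, {ω | t ≤ |Z i ω|} := by
    intro ω hω
    simp only [Set.mem_ofPred_eq, not_forall, not_le] at hω
    obtain ⟨i, hi⟩ := hω
    exact Set.mem_iUnion.2 ⟨i, hi.le⟩
  refine (measureReal_mono hsub (by finiteness)).trans ((measureReal_iUnion_fintype_le _).trans ?_)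
  refine (Finset.sum_le_sum fun i _ => h i).trans ?_
  rw [Finset.sum_const, nsmul_eq_mul, Finset.card_univ]

/-- The rate parameter `ζ` of the closeness condition. -/
noncomputable def MultParams.rate (θ : MultParams) (B : ℝ) : ℝ := ((1 + |B|) * θ.scale) ^ 2

theorem MultParams.rate_pos (θ : MultParams) (B : ℝ) : 0 < θ.rate B := by
  have := θ.scale_pos
  unfold rate
  positivity

theorem MultParams.scale_sq_le_rate (θ : MultParams) (B : ℝ) : θ.scale ^ 2 ≤ θ.rate B := by
  unfold rate
  have := θ.scale_pos
  gcongr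
  exact le_mul_of_one_le_left this.le (by linarith [abs_nonneg B])

theorem MultParams.sq_mul_scale_sq_le_rate (θ : MultParams) (B : ℝ) :
    B ^ 2 * θ.scale ^ 2 ≤ θ.rate B := by
  unfold rate
  rw [mul_pow]
  have h : B ^ 2 ≤ (1 + |B|) ^ 2 := by
    rw [← sq_abs]; gcongr; linarith
  gcongr

namespace MultData

variable {n p : ℕ} {Ω : Type*} {D : MultData n p Ω}

theorem scale_mul_sq_eq (θ : MultParams) :
    (D.s * (1 + D.B) * θ.scale) ^ 2 = D.s ^ 2 * θ.rate D.B := by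
  unfold MultParams.rate
  rw [abs_of_nonneg D.B_nonneg]
  ring

theorem one_le_s_mul_scale (θ : MultParams) (hs : 1 ≤ D.s) :
    1 ≤ D.s * (1 + D.B) * θ.scale := by
  have h1 := one_le_mul_of_one_le_of_one_le hs (by linarith [D.B_nonneg] : 1 ≤ 1 + D.B)
  exact one_le_mul_of_one_le_of_one_le h1 θ.one_le_scale

variable [MeasurableSpace Ω] {P : Measure Ω} {θ : MultParams} [IsProbabilityMeasure P]

/-- Union bound for the event that the surrogates are not close to their targets. -/
theorem measureReal_not_close_le {δ a q₁ q₂ : ℝ}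
    (h₁ : ∀ j k, P.real {ω | δ ≤ |D.SigHat ω j k - D.Sig j k|} ≤ q₁)
    (h₂ : ∀ j, P.real {ω | a ≤ |D.rhoTilde ω j - D.rho ω j|} ≤ q₂)
    (h₃ : ∀ j, P.real {ω | a ≤ |D.noiseCorr ω j|} ≤ q₂) (hq₂ : 0 ≤ q₂) :
    P.real {ω | ¬ ((∀ j k, |D.SigHat ω j k - D.Sig j k| ≤ δ) ∧
      (∀ j, |D.rhoTilde ω j - D.rho ω j| ≤ a) ∧ ∀ j, |D.noiseCorr ω j| ≤ a)} ≤
      (p : ℝ) ^ 2 * q₁ + (p : ℝ) ^ 2 * (2 * q₂) := by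
  have e₁ := measureReal_not_forall_abs_le (P := P)
    (Z := fun (jk : Fin p × Fin p) ω => D.SigHat ω jk.1 jk.2 - D.Sig jk.1 jk.2)
    (fun jk => h₁ jk.1 jk.2)
  have e₂ := measureReal_not_forall_abs_le (P := P)
    (Z := fun j ω => D.rhoTilde ω j - D.rho ω j) h₂
  have e₃ := measureReal_not_forall_abs_le (P := P) (Z := fun j ω => D.noiseCorr ω j) h₃
  simp only [Fintype.card_prod, Fintype.card_fin, Nat.cast_mul] at e₁ e₂ e₃
  have hp : (p : ℝ) ≤ (p : ℝ) ^ 2 := by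
    rw [sq]; exact_mod_cast Nat.le_mul_self p
  have hsub : {ω | ¬ ((∀ j k, |D.SigHat ω j k - D.Sig j k| ≤ δ) ∧
      (∀ j, |D.rhoTilde ω j - D.rho ω j| ≤ a) ∧ ∀ j, |D.noiseCorr ω j| ≤ a)} ⊆
      {ω | ¬ ∀ jk : Fin p × Fin p, |D.SigHat ω jk.1 jk.2 - D.Sig jk.1 jk.2| ≤ δ} ∪
      ({ω | ¬ ∀ j, |D.rhoTilde ω j - D.rho ω j| ≤ a} ∪ {ω | ¬ ∀ j, |D.noiseCorr ω j| ≤ a}) := by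
    intro ω hω
    simp only [Set.mem_union, Set.mem_ofPred_eq, Prod.forall] at hω ⊢
    tauto
  refine (measureReal_mono hsub (by finiteness)).trans ((measureReal_union_le _ _).trans ?_)
  have e₄ := measureReal_union_le (μ := P) {ω | ¬ ∀ j, |D.rhoTilde ω j - D.rho ω j| ≤ a}
    {ω | ¬ ∀ j, |D.noiseCorr ω j| ≤ a}
  have e₅ := mul_le_mul_of_nonneg_right hp hq₂
  linarith

theorem IsMultModel.measureReal_SigHat_le (hM : D.IsMultModel P θ) {t : ℝ} (ht : 0 < t)
    (ht1 : t ≤ 1) (j k : Fin p) :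
    P.real {ω | t ≤ |D.SigHat ω j k - D.Sig j k|} ≤
      2 * Real.exp (-(n * t ^ 2 / (288 * θ.scale ^ 2))) :=
  (hM.hasBernsteinTail_SigHat j k).1 t ht (ht1.trans θ.one_le_scale)

theorem IsMultModel.measureReal_rhoTilde_le (hM : D.IsMultModel P θ) (hs : 1 ≤ D.s) {t : ℝ}
    (ht : 0 < t) (ht1 : t ≤ 1) (j : Fin p) :
    P.real {ω | t ≤ |D.rhoTilde ω j - D.rho ω j|} ≤
      2 * Real.exp (-(n * t ^ 2 / (288 * (D.s ^ 2 * θ.rate D.B)))) := by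
  rw [← scale_mul_sq_eq]
  exact (hM.hasBernsteinTail_rhoTilde hs j).1 t ht (ht1.trans (one_le_s_mul_scale θ hs))

theorem IsMultModel.measureReal_noiseCorr_le (hM : D.IsMultModel P θ) (hs : 1 ≤ D.s) {t : ℝ}
    (ht : 0 < t) (ht1 : t ≤ 1) (j : Fin p) :
    P.real {ω | t ≤ |D.noiseCorr ω j|} ≤
      2 * Real.exp (-(n * t ^ 2 / (288 * (D.s ^ 2 * θ.rate D.B)))) := by
  rw [← scale_mul_sq_eq]
  exact (hM.hasBernsteinTail_noiseCorr hs j).1 t ht (ht1.trans (one_le_s_mul_scale θ hs))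

/-- The closeness condition for the surrogate of the Gram matrix. -/
theorem IsMultModel.closeness_SigHat (hM : D.IsMultModel P θ) {t : ℝ} (ht : 0 < t)
    (ht1 : t ≤ 1) (j k : Fin p) :
    P.real {ω | t ≤ |D.SigHat ω j k - D.Sig j k|} ≤
      24 * Real.exp (-(1 / 73728 * n * t ^ 2 / θ.rate D.B)) := by
  refine (hM.measureReal_SigHat_le ht ht1 j k).trans ?_
  have hK := θ.scale_pos
  have hle := θ.scale_sq_le_rate D.B
  refine mul_le_mul (by norm_num) (Real.exp_le_exp.2 (neg_le_neg ?_)) (Real.exp_pos _).le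
    (by norm_num)
  calc 1 / 73728 * n * t ^ 2 / θ.rate D.B ≤ 1 / 288 * n * t ^ 2 / θ.scale ^ 2 := by
        gcongr; norm_num
    _ = _ := by field_simp

/-- The closeness condition for the surrogate of `ρ`. -/
theorem IsMultModel.closeness_rhoTilde (hM : D.IsMultModel P θ) {t : ℝ} (ht : 0 < t)
    (ht1 : t ≤ 1) (j : Fin p) :
    P.real {ω | t ≤ |D.rhoTilde ω j - D.rho ω j|} ≤
      24 * Real.exp (-(1 / 73728 * n * t ^ 2 / (D.s ^ 2 * θ.rate D.B))) := by
  have hdich : D.s = 0 ∨ 1 ≤ D.s := by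
    unfold s
    rcases Nat.eq_zero_or_pos D.S.card with h | h
    · left; exact_mod_cast h
    · right; exact_mod_cast h
  rcases hdich with h | h
  · rw [h]
    refine measureReal_le_one.trans ?_
    norm_num
  · refine (hM.measureReal_rhoTilde_le h ht ht1 j).trans ?_
    have hr := θ.rate_pos D.B
    have hs : 0 < D.s := by linarith
    refine mul_le_mul (by norm_num) (Real.exp_le_exp.2 (neg_le_neg ?_)) (Real.exp_pos _).le
      (by norm_num)
    calc 1 / 73728 * n * t ^ 2 / (D.s ^ 2 * θ.rate D.B)
        ≤ 1 / 288 * n * t ^ 2 / (D.s ^ 2 * θ.rate D.B) := by gcongr; norm_num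
      _ = _ := by field_simp

/-- Existence of and error bounds for the estimates, with high probability. -/
theorem IsMultModel.error_bounds (hM : D.IsMultModel P θ) (hΩ : 0 < D.restrictedEigenvalue)
    {lam ε : ℝ} (hlam : 0 < lam) (hlam1 : lam ≤ 1) (hlamB : lam ≤ 12 * D.B)
    (hε : 0 < ε) (hε1 : ε ≤ 1) (hε2 : ε ≤ D.restrictedEigenvalue / (64 * D.s)) :
    P.real {ω | ¬ ∀ A, IsNearestPSD (D.SigHat ω) A →
        (∃ b, IsLassoMin A (D.rhoTilde ω) lam b) ∧
        ∀ b, IsLassoMin A (D.rhoTilde ω) lam b →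
          Real.sqrt (∑ j, (b j - D.β j) ^ 2)
            ≤ 24 * lam * Real.sqrt D.s / D.restrictedEigenvalue ∧
          ∑ j, |b j - D.β j| ≤ 24 * lam * D.s / D.restrictedEigenvalue}
      ≤ (p : ℝ) ^ 2 * 24 * Real.exp (-(1 / 73728 * n * lam ^ 2 / (D.s ^ 2 * θ.rate D.B)))
        + (p : ℝ) ^ 2 * 24 * Real.exp (-(1 / 73728 * n * ε ^ 2 / θ.rate D.B)) := by
  have hs := s_pos_of_restrictedEigenvalue_pos hΩ
  have hs0 : 0 < D.s := by linarith
  have hB := B_pos_of_s_pos hs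
  have hK := θ.scale_pos
  have hr := θ.rate_pos D.B
  set δ := lam / (12 * (D.s * D.B)) with hδ
  have hδ0 : 0 < δ := by positivity
  have hδ1 : δ ≤ 1 := by
    rw [hδ, div_le_one (by positivity)]
    nlinarith
  have hδB : 2 * δ * D.s * D.B = lam / 6 := by
    rw [hδ]; field_simp; norm_num
  set X := Real.exp (-(1 / 73728 * n * lam ^ 2 / (D.s ^ 2 * θ.rate D.B))) with hX
  have hX1 : Real.exp (-(n * δ ^ 2 / (288 * θ.scale ^ 2))) ≤ X := by
    refine Real.exp_le_exp.2 (neg_le_neg ?_)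
    have h1 := θ.sq_mul_scale_sq_le_rate D.B
    calc 1 / 73728 * n * lam ^ 2 / (D.s ^ 2 * θ.rate D.B)
        ≤ 1 / 41472 * n * lam ^ 2 / (D.s ^ 2 * (D.B ^ 2 * θ.scale ^ 2)) := by
          gcongr; norm_num
      _ = n * δ ^ 2 / (288 * θ.scale ^ 2) := by rw [hδ]; field_simp; ring
  have hX2 : Real.exp (-(n * (lam / 6) ^ 2 / (288 * (D.s ^ 2 * θ.rate D.B)))) ≤ X := by
    refine Real.exp_le_exp.2 (neg_le_neg ?_)
    calc 1 / 73728 * n * lam ^ 2 / (D.s ^ 2 * θ.rate D.B)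
        ≤ 1 / 10368 * n * lam ^ 2 / (D.s ^ 2 * θ.rate D.B) := by
          gcongr; norm_num
      _ = _ := by field_simp; ring
  have e₁ := measureReal_not_close_le (P := P) (D := D) (δ := δ) (a := lam / 6) (q₁ := 2 * X)
    (q₂ := 2 * X)
    (fun j k => (hM.measureReal_SigHat_le hδ0 hδ1 j k).trans (by gcongr))
    (fun j => (hM.measureReal_rhoTilde_le hs (by positivity) (by linarith) j).trans (by gcongr))
    (fun j => (hM.measureReal_noiseCorr_le hs (by positivity) (by linarith) j).trans (by gcongr))
    (by positivity)
  have e₂ := measureReal_not_forall_abs_le (P := P)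
    (Z := fun (jk : Fin p × Fin p) ω => D.SigHat ω jk.1 jk.2 - D.Sig jk.1 jk.2)
    (fun jk => hM.closeness_SigHat hε hε1 jk.1 jk.2)
  simp only [Fintype.card_prod, Fintype.card_fin, Nat.cast_mul] at e₂
  refine (measureReal_mono (s₂ := {ω | ¬ ((∀ j k, |D.SigHat ω j k - D.Sig j k| ≤ δ) ∧
      (∀ j, |D.rhoTilde ω j - D.rho ω j| ≤ lam / 6) ∧ ∀ j, |D.noiseCorr ω j| ≤ lam / 6)} ∪
      {ω | ¬ ∀ jk : Fin p × Fin p, |D.SigHat ω jk.1 jk.2 - D.Sig jk.1 jk.2| ≤ ε})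
      ?_ (by finiteness)).trans ((measureReal_union_le _ _).trans ?_)
  · intro ω hω
    by_contra hcon
    simp only [Set.mem_union, Set.mem_ofPred_eq, not_or, not_not, Prod.forall] at hcon
    obtain ⟨⟨h1, h2, h3⟩, h4⟩ := hcon
    refine hω fun A hA => ?_
    have := error_bounds_of_close hΩ hlam hε.le hδ0.le hε2 (by rw [hδB]; linarith) h4 h1 h2 h3 hA
    refine ⟨this.1, fun b hb => ⟨(this.2 b hb).1.trans ?_, (this.2 b hb).2⟩⟩
    gcongr
    norm_num
  · have hX0 : 0 ≤ (p : ℝ) ^ 2 * X := by positivity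
    linarith

/-- Support recovery, `ℓ_∞` error bound and sign recovery, with high probability. -/
theorem IsMultModel.support_recovery (hM : D.IsMultModel P θ) (hI : D.Irrepresentable)
    {lam ε : ℝ} (hlam : 0 < lam) (hlam1 : D.gam * lam ≤ 4) (hε : 0 < ε)
    (hε1 : ε ≤ 1) (hεφ : 32 * infNorm D.SigSS⁻¹ * ε ≤ D.gam)
    (hεB : 16 * D.B * ε ≤ D.gam * lam) :
    P.real {ω | ¬ ∀ A, IsNearestPSD (D.SigHat ω) A →
        ∃ b, IsLassoMin A (D.rhoTilde ω) lam b ∧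
          (∀ b', IsLassoMin A (D.rhoTilde ω) lam b' → b' = b) ∧
          (∀ j, j ∉ D.S → b j = 0) ∧
          (∀ j ∈ D.S, |b j - D.β j| ≤ D.kap * lam) ∧
          (D.kap * lam ≤ D.betaMin →
            ∀ j ∈ D.S, SignType.sign (b j) = SignType.sign (D.β j))}
      ≤ (p : ℝ) ^ 2 * 24 *
          Real.exp (-(1 / 73728 * n * D.gam ^ 2 * lam ^ 2 / (D.s ^ 2 * θ.rate D.B)))
        + (p : ℝ) ^ 2 * 24 * Real.exp (-(1 / 73728 * n * ε ^ 2 / (D.s ^ 2 * θ.rate D.B))) := by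
  have hs := hI.one_le_s
  have hs0 : 0 < D.s := by linarith
  have hK := θ.scale_pos
  have hr := θ.rate_pos D.B
  have hγ := hI.1
  have hδs : ε / D.s * D.s = ε := by field_simp
  set a := D.gam * lam / 16 with ha
  have ha0 : 0 < a := by positivity
  have ha1 : a ≤ 1 := by linarith
  set X := Real.exp (-(1 / 73728 * n * D.gam ^ 2 * lam ^ 2 / (D.s ^ 2 * θ.rate D.B))) with hX
  set Y := Real.exp (-(1 / 73728 * n * ε ^ 2 / (D.s ^ 2 * θ.rate D.B))) with hY
  have hY1 : Real.exp (-(n * (ε / D.s) ^ 2 / (288 * θ.scale ^ 2))) ≤ Y := by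
    refine Real.exp_le_exp.2 (neg_le_neg ?_)
    have h1 := θ.scale_sq_le_rate D.B
    calc 1 / 73728 * n * ε ^ 2 / (D.s ^ 2 * θ.rate D.B)
        ≤ 1 / 288 * n * ε ^ 2 / (D.s ^ 2 * θ.scale ^ 2) := by gcongr; norm_num
      _ = _ := by field_simp
  have hX1 : Real.exp (-(n * a ^ 2 / (288 * (D.s ^ 2 * θ.rate D.B)))) ≤ X := by
    refine Real.exp_le_exp.2 (neg_le_neg (le_of_eq ?_))
    rw [ha]; field_simp; ring
  have e₁ := measureReal_not_close_le (P := P) (D := D) (δ := ε / D.s) (a := a) (q₁ := 2 * Y)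
    (q₂ := 2 * X)
    (fun j k => (hM.measureReal_SigHat_le (by positivity)
      (div_le_one_of_le₀ (hε1.trans hs) hs0.le) j k).trans (by gcongr))
    (fun j => (hM.measureReal_rhoTilde_le hs ha0 ha1 j).trans (by gcongr))
    (fun j => (hM.measureReal_noiseCorr_le hs ha0 ha1 j).trans (by gcongr))
    (by positivity)
  refine (measureReal_mono ?_ (by finiteness)).trans (e₁.trans ?_)
  · intro ω hω hcon
    obtain ⟨h1, h2, h3⟩ := hcon
    refine hω fun A hA => ?_
    refine support_recovery_of_close hI hlam (by positivity) ?_ ?_ h1 h2 h3 hA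
    · rw [mul_assoc 2, hδs]; linarith
    · rw [mul_assoc 2, hδs, ha]; linarith
  · have hX0 : 0 ≤ (p : ℝ) ^ 2 * X := by positivity
    have hY0 : 0 ≤ (p : ℝ) ^ 2 * Y := by positivity
    linarith

/-! ### Asymptotic sign consistency -/

section Asymptotic

theorem kap_pos {n p : ℕ} {Ω : Type*} {D : MultData n p Ω} (hI : D.Irrepresentable) :
    0 < D.kap := by
  have h1 := infNorm_nonneg D.SigSS⁻¹
  have h2 : 0 < (Real.sqrt D.Cmin)⁻¹ := inv_pos.2 (Real.sqrt_pos.2 hI.2)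
  unfold kap
  linarith

theorem betaMin_nonneg {n p : ℕ} {Ω : Type*} (D : MultData n p Ω) : 0 ≤ D.betaMin :=
  Real.iInf_nonneg fun _ => abs_nonneg _

/-- Support recovery without restrictions on the size of the penalty, for `log p` small compared
with the sample size. -/
theorem IsMultModel.support_recovery_of_log_le {n p : ℕ} {Ω : Type*} {D : MultData n p Ω}
    [MeasurableSpace Ω] {P : Measure Ω} {θ : MultParams} [IsProbabilityMeasure P]
    (hM : D.IsMultModel P θ) (hI : D.Irrepresentable) {lam γ₀ κ₀ : ℝ} (hlam : 0 < lam)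
    (hγ₀ : 0 < γ₀) (hγ : γ₀ ≤ D.gam) (hκ : D.kap ≤ κ₀)
    (h1 : 3 * Real.log p ≤ n / 288)
    (h2 : 3 * Real.log p * (18432 * κ₀ ^ 2 * D.s ^ 2 * θ.scale ^ 2) ≤ n * γ₀ ^ 2)
    (h3 : 3 * Real.log p * (73728 * (D.s ^ 2 * θ.rate D.B)) ≤ n * (γ₀ * lam) ^ 2) :
    P.real {ω | ¬ ∀ A, IsNearestPSD (D.SigHat ω) A →
        ∃ b, IsLassoMin A (D.rhoTilde ω) lam b ∧
          (∀ b', IsLassoMin A (D.rhoTilde ω) lam b' → b' = b) ∧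
          (∀ j, j ∉ D.S → b j = 0) ∧
          (∀ j ∈ D.S, |b j - D.β j| ≤ D.kap * lam) ∧
          (D.kap * lam ≤ D.betaMin →
            ∀ j ∈ D.S, SignType.sign (b j) = SignType.sign (D.β j))} ≤ 12 / p := by
  have hs := hI.one_le_s
  have hs0 : 0 < D.s := by linarith
  have hB := B_pos_of_s_pos hs
  have hK := θ.scale_pos
  have hr := θ.rate_pos D.B
  have hκ0 : 0 < κ₀ := (kap_pos hI).trans_le hκ
  have hp : 1 ≤ p := by
    by_contra hcon
    have hp0 : p = 0 := by omega
    subst hp0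
    have : D.S = ∅ := Finset.eq_empty_of_isEmpty _
    unfold s at hs
    rw [this] at hs
    norm_num at hs
  have hp' : (0 : ℝ) < p := by exact_mod_cast hp
  have hL : 0 ≤ Real.log p := Real.log_nonneg (by exact_mod_cast hp)
  set X := Real.exp (-(3 * Real.log p)) with hX
  have hXp : (p : ℝ) ^ 2 * X = 1 / p := by
    rw [hX, Real.exp_neg, show 3 * Real.log p = Real.log ((p : ℝ) ^ 3) by
      rw [Real.log_pow]; norm_num, Real.exp_log (by positivity)]
    field_simp
  have hexp : ∀ {x : ℝ}, 3 * Real.log p ≤ x → Real.exp (-x) ≤ X := fun h =>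
    Real.exp_le_exp.2 (neg_le_neg h)
  have hn := hexp h1
  set δ := min (γ₀ * lam / (16 * (D.s * D.B))) (γ₀ / (8 * κ₀ * D.s)) with hδ
  have hδ0 : 0 < δ := lt_min (by positivity) (by positivity)
  have hδ1 : δ ≤ γ₀ * lam / (16 * (D.s * D.B)) := min_le_left _ _
  have hδ2 : δ ≤ γ₀ / (8 * κ₀ * D.s) := min_le_right _ _
  have hXδ : Real.exp (-(n * δ ^ 2 / (288 * θ.scale ^ 2))) ≤ X := by
    apply hexp
    rw [le_div_iff₀ (by positivity)]
    rcases min_choice (γ₀ * lam / (16 * (D.s * D.B))) (γ₀ / (8 * κ₀ * D.s)) with h | h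
    · rw [hδ, h, div_pow, mul_div_assoc', le_div_iff₀ (by positivity)]
      refine le_trans ?_ h3
      have := θ.sq_mul_scale_sq_le_rate D.B
      calc 3 * Real.log p * (288 * θ.scale ^ 2) * (16 * (D.s * D.B)) ^ 2
          = 3 * Real.log p * (73728 * (D.s ^ 2 * (D.B ^ 2 * θ.scale ^ 2))) := by ring
        _ ≤ _ := by gcongr
    · rw [hδ, h, div_pow, mul_div_assoc', le_div_iff₀ (by positivity)]
      refine le_trans (le_of_eq ?_) h2
      ring
  set a := γ₀ * lam / 16 with ha
  have ha0 : 0 < a := by positivity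
  have hXa : Real.exp (-(n * a ^ 2 / (288 * (D.s ^ 2 * θ.rate D.B)))) ≤ X := by
    apply hexp
    rw [le_div_iff₀ (by positivity), ha, div_pow, mul_div_assoc', le_div_iff₀ (by positivity)]
    refine le_trans (le_of_eq ?_) h3
    ring
  have e₁ := measureReal_not_close_le (P := P) (D := D) (δ := δ) (a := a) (q₁ := 4 * X)
    (q₂ := 4 * X)
    (fun j k => ((hM.hasBernsteinTail_SigHat j k).2 δ hδ0).trans (by linarith))
    (fun j => ((hM.hasBernsteinTail_rhoTilde hs j).2 a ha0).trans (by
      rw [scale_mul_sq_eq]; linarith))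
    (fun j => ((hM.hasBernsteinTail_noiseCorr hs j).2 a ha0).trans (by
      rw [scale_mul_sq_eq]; linarith))
    (by positivity)
  refine (measureReal_mono ?_ (by finiteness)).trans (e₁.trans (le_of_eq ?_))
  · intro ω hω hcon
    obtain ⟨g1, g2, g3⟩ := hcon
    refine hω fun A hA => ?_
    refine support_recovery_of_close hI hlam hδ0.le ?_ ?_ g1 g2 g3 hA
    · have hφ : infNorm D.SigSS⁻¹ ≤ κ₀ / 4 := by
        have : 0 < (Real.sqrt D.Cmin)⁻¹ := inv_pos.2 (Real.sqrt_pos.2 hI.2)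
        unfold kap at hκ
        linarith
      have hφ0 := infNorm_nonneg D.SigSS⁻¹
      calc 2 * δ * D.s * infNorm D.SigSS⁻¹
          ≤ 2 * (γ₀ / (8 * κ₀ * D.s)) * D.s * (κ₀ / 4) := by gcongr
        _ = γ₀ / 16 := by field_simp; norm_num
        _ ≤ D.gam / 16 := by gcongr
    · have e : 2 * δ * D.s * D.B ≤ γ₀ * lam / 8 := by
        calc 2 * δ * D.s * D.B ≤ 2 * (γ₀ * lam / (16 * (D.s * D.B))) * D.s * D.B := by gcongr
          _ = γ₀ * lam / 8 := by field_simp; norm_num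
      have : γ₀ * lam ≤ D.gam * lam := by gcongr
      rw [ha]
      linarith
  · linear_combination 12 * hXp

variable {n p : ℕ → ℕ} {Ω : ℕ → Type*} [∀ k, MeasurableSpace (Ω k)] {P : ∀ k, Measure (Ω k)}
  [∀ k, IsProbabilityMeasure (P k)] {θ : MultParams} {D : ∀ k, MultData (n k) (p k) (Ω k)}
  {lam : ℕ → ℝ} {γ₀ κ₀ : ℝ}

theorem eventually_support_recovery (hM : ∀ k, (D k).IsMultModel (P k) θ)
    (hI : ∀ k, (D k).Irrepresentable) (hγ₀ : 0 < γ₀) (hγ : ∀ k, γ₀ ≤ (D k).gam)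
    (hκ : ∀ k, (D k).kap ≤ κ₀) (hn : Tendsto n atTop atTop)
    (hlog : Tendsto (fun k => (D k).s ^ 2 * Real.log (p k) / (n k)) atTop (𝓝 0))
    (hlam : ∀ k, 0 < lam k)
    (hlarge : (fun k => (D k).s * Real.sqrt (θ.rate (D k).B * Real.log (p k) / (n k)))
      =o[atTop] lam) :
    ∀ᶠ k in atTop, (P k).real {ω | ¬ ∀ A, IsNearestPSD ((D k).SigHat ω) A →
        ∃ b, IsLassoMin A ((D k).rhoTilde ω) (lam k) b ∧
          (∀ b', IsLassoMin A ((D k).rhoTilde ω) (lam k) b' → b' = b) ∧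
          (∀ j, j ∉ (D k).S → b j = 0) ∧
          (∀ j ∈ (D k).S, |b j - (D k).β j| ≤ (D k).kap * lam k) ∧
          ((D k).kap * lam k ≤ (D k).betaMin →
            ∀ j ∈ (D k).S, SignType.sign (b j) = SignType.sign ((D k).β j))} ≤ 12 / p k := by
  have hK := θ.scale_pos
  have hκ0 : 0 < κ₀ := (kap_pos (hI 0)).trans_le (hκ 0)
  have ev1 : ∀ᶠ k in atTop, (D k).s ^ 2 * Real.log (p k) / (n k) ≤ 1 / 864 :=
    hlog.eventually (eventually_le_nhds (by norm_num))
  have ev2 : ∀ᶠ k in atTop, (D k).s ^ 2 * Real.log (p k) / (n k) ≤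
      γ₀ ^ 2 / (55296 * κ₀ ^ 2 * θ.scale ^ 2) :=
    hlog.eventually (eventually_le_nhds (by positivity))
  have ev3 := hlarge.def (show 0 < γ₀ / 512 by positivity)
  filter_upwards [ev1, ev2, ev3, hn.eventually_ge_atTop 1] with k k1 k2 k3 kn
  have hn0 : (0 : ℝ) < n k := by exact_mod_cast kn
  have hs := (hI k).one_le_s
  have hr := θ.rate_pos (D k).B
  have hL : 0 ≤ Real.log (p k) := Real.log_natCast_nonneg _
  refine (hM k).support_recovery_of_log_le (hI k) (hlam k) hγ₀ (hγ k) (hκ k) ?_ ?_ ?_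
  · rw [div_le_iff₀ hn0] at k1
    have : Real.log (p k) ≤ (D k).s ^ 2 * Real.log (p k) :=
      le_mul_of_one_le_left hL (one_le_pow₀ hs)
    linarith
  · rw [div_le_div_iff₀ hn0 (by positivity)] at k2
    linarith
  · rw [Real.norm_of_nonneg (mul_nonneg (by linarith) (Real.sqrt_nonneg _)),
      Real.norm_of_nonneg (hlam k).le] at k3
    have k4 := pow_le_pow_left₀ (mul_nonneg (by linarith) (Real.sqrt_nonneg _)) k3 2
    rw [mul_pow, Real.sq_sqrt (by positivity), mul_div_assoc', div_le_iff₀ hn0] at k4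
    have : 0 ≤ n k * (γ₀ * lam k) ^ 2 := by positivity
    nlinarith

theorem tendsto_of_eventually_le_twelve_div {q : ℕ → ℝ} (hq : ∀ k, 0 ≤ q k)
    (hp : Tendsto p atTop atTop) (h : ∀ᶠ k in atTop, q k ≤ 12 / p k) :
    Tendsto q atTop (𝓝 0) :=
  squeeze_zero' (Eventually.of_forall hq) h
    (tendsto_const_nhds.div_atTop (tendsto_natCast_atTop_atTop.comp hp))

theorem tendsto_sup_norm_bound (hM : ∀ k, (D k).IsMultModel (P k) θ)
    (hI : ∀ k, (D k).Irrepresentable) (hγ₀ : 0 < γ₀) (hγ : ∀ k, γ₀ ≤ (D k).gam)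
    (hκ : ∀ k, (D k).kap ≤ κ₀) (hn : Tendsto n atTop atTop) (hp : Tendsto p atTop atTop)
    (hlog : Tendsto (fun k => (D k).s ^ 2 * Real.log (p k) / (n k)) atTop (𝓝 0))
    (hlam : ∀ k, 0 < lam k)
    (hlarge : (fun k => (D k).s * Real.sqrt (θ.rate (D k).B * Real.log (p k) / (n k)))
      =o[atTop] lam) :
    Tendsto (fun k => (P k).real {ω | ¬ ∀ A, IsNearestPSD ((D k).SigHat ω) A →
      (∃ b, IsLassoMin A ((D k).rhoTilde ω) (lam k) b) ∧
      ∀ b, IsLassoMin A ((D k).rhoTilde ω) (lam k) b →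
        ∀ j ∈ (D k).S, |b j - (D k).β j| ≤ (D k).kap * lam k}) atTop (𝓝 0) := by
  refine tendsto_of_eventually_le_twelve_div (fun _ => measureReal_nonneg) hp ?_
  filter_upwards [eventually_support_recovery hM hI hγ₀ hγ hκ hn hlog hlam hlarge] with k hk
  refine (measureReal_mono ?_ (by finiteness)).trans hk
  intro ω hω hcon
  refine hω fun A hA => ?_
  obtain ⟨b, hb, huniq, -, hbd, -⟩ := hcon A hA
  exact ⟨⟨b, hb⟩, fun b' hb' => huniq b' hb' ▸ hbd⟩

theorem tendsto_sign_consistency (hM : ∀ k, (D k).IsMultModel (P k) θ)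
    (hI : ∀ k, (D k).Irrepresentable) (hγ₀ : 0 < γ₀) (hγ : ∀ k, γ₀ ≤ (D k).gam)
    (hκ : ∀ k, (D k).kap ≤ κ₀) (hn : Tendsto n atTop atTop) (hp : Tendsto p atTop atTop)
    (hlog : Tendsto (fun k => (D k).s ^ 2 * Real.log (p k) / (n k)) atTop (𝓝 0))
    (hlam : ∀ k, 0 < lam k)
    (hlarge : (fun k => (D k).s * Real.sqrt (θ.rate (D k).B * Real.log (p k) / (n k)))
      =o[atTop] lam)
    (hsmall : lam =o[atTop] fun k => (D k).betaMin) :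
    Tendsto (fun k => (P k).real {ω | ¬ ∀ A, IsNearestPSD ((D k).SigHat ω) A →
      (∃ b, IsLassoMin A ((D k).rhoTilde ω) (lam k) b) ∧
      ∀ b, IsLassoMin A ((D k).rhoTilde ω) (lam k) b →
        ∀ j, SignType.sign (b j) = SignType.sign ((D k).β j)}) atTop (𝓝 0) := by
  have hκ0 : 0 < κ₀ := (kap_pos (hI 0)).trans_le (hκ 0)
  refine tendsto_of_eventually_le_twelve_div (fun _ => measureReal_nonneg) hp ?_
  filter_upwards [eventually_support_recovery hM hI hγ₀ hγ hκ hn hlog hlam hlarge,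
    hsmall.def (inv_pos.2 hκ0)] with k hk hβ
  have hβ' : (D k).kap * lam k ≤ (D k).betaMin := by
    rw [Real.norm_of_nonneg (hlam k).le, Real.norm_of_nonneg (betaMin_nonneg _), inv_mul_eq_div,
      le_div_iff₀ hκ0] at hβ
    have := mul_le_mul_of_nonneg_right (hκ k) (hlam k).le
    linarith
  refine (measureReal_mono ?_ (by finiteness)).trans hk
  intro ω hω hcon
  refine hω fun A hA => ?_
  obtain ⟨b, hb, huniq, hsupp, -, hsign⟩ := hcon A hA
  refine ⟨⟨b, hb⟩, fun b' hb' j => ?_⟩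
  rw [huniq b' hb']
  by_cases hj : j ∈ (D k).S
  · exact hsign hβ' j hj
  · rw [hsupp j hj, (D k).beta_eq_zero hj]

end Asymptotic

end MultData

/-! ### Randomly missing data -/

section Indicator

variable {Ω : Type*} [MeasurableSpace Ω] {P : Measure Ω}

theorem integral_of_eq_zero_or_one {m : Ω → ℝ} (hm : Measurable m)
    (h : ∀ ω, m ω = 0 ∨ m ω = 1) : ∫ ω, m ω ∂P = P.real {ω | m ω = 1} := by
  have hset : MeasurableSet {ω | m ω = 1} := hm (measurableSet_singleton 1)
  rw [← integral_indicator_one hset]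
  congr 1
  funext ω
  rcases h ω with h | h <;> simp [Set.indicator, h]

variable [IsProbabilityMeasure P]

theorem map_eq_of_eq_zero_or_one {m m' : Ω → ℝ} (hm : Measurable m) (hm' : Measurable m')
    (h : ∀ ω, m ω = 0 ∨ m ω = 1) (h' : ∀ ω, m' ω = 0 ∨ m' ω = 1)
    (hP : P.real {ω | m ω = 1} = P.real {ω | m' ω = 1}) : P.map m = P.map m' := by
  have key : ∀ {f : Ω → ℝ}, Measurable f → (∀ ω, f ω = 0 ∨ f ω = 1) → ∀ A, MeasurableSet A →
      (P.map f).real A = A.indicator 1 1 * P.real {ω | f ω = 1} +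
        A.indicator 1 0 * (1 - P.real {ω | f ω = 1}) := by
    intro f hf h01 A hA
    have hset : MeasurableSet {ω | f ω = 1} := hf (measurableSet_singleton 1)
    rw [map_measureReal_apply hf hA]
    have hsplit := measureReal_inter_add_sdiff (μ := P) (s := f ⁻¹' A) hset
    rw [← hsplit]
    congr 1
    · by_cases h1 : (1 : ℝ) ∈ A
      · rw [Set.indicator_of_mem h1, Pi.one_apply, one_mul]
        congr 1
        ext ω
        simp only [Set.mem_inter_iff, Set.mem_preimage, Set.mem_ofPred_eq, and_iff_right_iff_imp]
        intro hω
        rwa [hω]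
      · rw [Set.indicator_of_notMem h1, zero_mul]
        convert measureReal_empty
        ext ω
        simp only [Set.mem_inter_iff, Set.mem_preimage, Set.mem_ofPred_eq,
          Set.mem_empty_iff_false, iff_false, not_and]
        intro hω h2
        exact h1 (h2 ▸ hω)
    · by_cases h0 : (0 : ℝ) ∈ A
      · rw [Set.indicator_of_mem h0, Pi.one_apply, one_mul, ← probReal_compl_eq_one_sub hset]
        congr 1
        ext ω
        simp only [Set.mem_sdiff, Set.mem_preimage, Set.mem_ofPred_eq, Set.mem_compl_iff,
          and_iff_right_iff_imp]
        intro hω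
        rcases h01 ω with h2 | h2
        · rwa [h2]
        · exact absurd h2 hω
      · rw [Set.indicator_of_notMem h0, zero_mul]
        convert measureReal_empty
        ext ω
        simp only [Set.mem_sdiff, Set.mem_preimage, Set.mem_ofPred_eq,
          Set.mem_empty_iff_false, iff_false, not_and, not_not]
        intro hω
        rcases h01 ω with h2 | h2
        · exact absurd (h2 ▸ hω) h0
        · exact h2
  have := Measure.isProbabilityMeasure_map (μ := P) hm.aemeasurable
  have := Measure.isProbabilityMeasure_map (μ := P) hm'.aemeasurable
  refine Measure.ext fun A hA => ?_
  rw [← measureReal_eq_measureReal_iff, key hm h A hA, key hm' h' A hA, hP]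

theorem hasSubGaussianTail_of_hasSubgaussianMGF {Y : Ω → ℝ} {τ : ℝ} {c : NNReal}
    (h : HasSubgaussianMGF Y c P) (hc : (c : ℝ) = τ ^ 2) : HasSubGaussianTail P Y τ := by
  intro t ht
  have h1 := h.measure_ge_le ht.le
  have h2 := h.neg.measure_ge_le ht.le
  rw [hc, neg_div] at h1 h2
  have hsub : {ω | t < |Y ω|} ⊆ {ω | t ≤ Y ω} ∪ {ω | t ≤ (-Y) ω} := fun ω hω =>
    (le_abs.1 (le_of_lt hω : t ≤ |Y ω|))
  have h3 := (measureReal_mono hsub (by finiteness)).trans (measureReal_union_le (μ := P) _ _)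
  linarith

end Indicator

namespace MultData

variable {n p : ℕ} {Ω : Type*} {D : MultData n p Ω} [MeasurableSpace Ω] {P : Measure Ω} {r : Fin p → ℝ}

theorem IsMissingData.measurable_entry (hD : D.IsMissingData P r) (i : Fin n) (j : Fin p) :
    Measurable fun ω => D.M i ω j := measurable_pi_iff.1 (hD.M_measurable i) j

theorem IsMissingData.iIndepFun_row (hD : D.IsMissingData P r) (i : Fin n) :
    iIndepFun (fun j ω => D.M i ω j) P :=
  hD.M_indep.precomp (g := fun j => (i, j)) fun _ _ h => (Prod.mk.inj h).2

theorem IsMissingData.integral_entry (hD : D.IsMissingData P r) (i : Fin n) (j : Fin p) :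
    ∫ ω, D.M i ω j ∂P = 1 - r j := by
  rw [integral_of_eq_zero_or_one (hD.measurable_entry i j) fun ω => hD.indicator i ω j, hD.prob]

variable [IsProbabilityMeasure P]

theorem IsMissingData.memLp_entry (hD : D.IsMissingData P r) (i : Fin n) (j : Fin p) :
    MemLp (fun ω => D.M i ω j) 2 P := by
  refine MemLp.of_bound (hD.measurable_entry i j).aestronglyMeasurable 1
    (Eventually.of_forall fun ω => ?_)
  rcases hD.indicator i ω j with h | h <;> simp [h]

theorem IsMissingData.covariance_entry (hD : D.IsMissingData P r) (i : Fin n) (j k : Fin p) :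
    cov[fun ω => D.M i ω j, fun ω => D.M i ω k; P] = D.covM j k := by
  rw [hD.cov_eq]
  by_cases hjk : j = k
  · subst hjk
    rw [covariance_eq_sub (hD.memLp_entry i j) (hD.memLp_entry i j), Matrix.diagonal_apply_eq]
    have h1 : (fun ω => D.M i ω j) * (fun ω => D.M i ω j) = fun ω => D.M i ω j := by
      funext ω
      rcases hD.indicator i ω j with h | h <;> simp [h]
    rw [h1, hD.integral_entry]
    ring
  · rw [Matrix.diagonal_apply_ne _ hjk]
    have hind : IndepFun (fun ω => D.M i ω j) (fun ω => D.M i ω k) P :=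
      hD.M_indep.indepFun (i := (i, j)) (j := (i, k)) fun h => hjk (Prod.mk.inj h).2
    exact hind.covariance_eq_zero (hD.memLp_entry i j) (hD.memLp_entry i k)

theorem IsMissingData.isSubGaussianVector (hD : D.IsMissingData P r) (i : Fin n) :
    IsSubGaussianVector P (D.M i) (1 / 2) := by
  intro v hv
  have hsub : ∀ j, HasSubgaussianMGF (fun ω => v j * (D.M i ω j - ∫ ω', D.M i ω' j ∂P))
      (Real.toNNReal (v j ^ 2) * (‖(1 : ℝ) - 0‖₊ / 2) ^ 2) P := fun j => by
    rw [Real.toNNReal_of_nonneg (sq_nonneg _)]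
    exact (hasSubgaussianMGF_of_mem_Icc (hD.measurable_entry i j).aemeasurable
      (Eventually.of_forall fun ω => by
        rcases hD.indicator i ω j with h | h <;> simp [h])).const_mul (v j)
  have hind : iIndepFun (fun j ω => v j * (D.M i ω j - ∫ ω', D.M i ω' j ∂P)) P :=
    (hD.iIndepFun_row i).comp (fun j x => v j * (x - ∫ ω', D.M i ω' j ∂P)) fun j => by fun_prop
  refine hasSubGaussianTail_of_hasSubgaussianMGF
    (HasSubgaussianMGF.sum_of_iIndepFun hind fun j _ => hsub j) ?_
  rw [← Finset.sum_mul]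
  push_cast
  simp only [Real.coe_toNNReal _ (sq_nonneg _), hv]
  norm_num

theorem IsMissingData.identDistrib_row (hD : D.IsMissingData P r) (i i' : Fin n) :
    IdentDistrib (D.M i) (D.M i') P P := by
  refine ⟨(hD.M_measurable i).aemeasurable, (hD.M_measurable i').aemeasurable, ?_⟩
  have h1 := (hD.iIndepFun_row i).map_fun_eq_pi_map
    fun j => (hD.measurable_entry i j).aemeasurable
  have h2 := (hD.iIndepFun_row i').map_fun_eq_pi_map
    fun j => (hD.measurable_entry i' j).aemeasurable
  refine h1.trans (Eq.trans ?_ h2.symm)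
  congr 1
  funext j
  exact map_eq_of_eq_zero_or_one (hD.measurable_entry i j) (hD.measurable_entry i' j)
    (fun ω => hD.indicator i ω j) (fun ω => hD.indicator i' ω j) (by rw [hD.prob, hD.prob])

/-- Randomly missing data form a multiplicative error model. -/
theorem IsMissingData.isMultModel {σ Xmax rmax : ℝ} (hD : D.IsMissingData P r)
    (hR : D.IsRegression P σ Xmax) (hrmax : rmax < 1) (hr : ∀ j, r j ≤ rmax) :
    D.IsMultModel P { τ := 1 / 2, σ := σ, Xmax := Xmax, Mmin := (1 - rmax) ^ 2,
                      μmin := 1 - rmax, μmax := 1 } := by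
  have h1 : 0 < 1 - rmax := by linarith
  have hr0 : ∀ j, 0 ≤ r j := by
    intro j
    have hn : 0 < n := by
      rcases Nat.eq_zero_or_pos n with rfl | h
      · have := hR.normalized j
        simp at this
      · exact h
    have h2 := hD.prob ⟨0, hn⟩ j
    have h3 : P.real {ω | D.M ⟨0, hn⟩ ω j = 1} ≤ 1 := measureReal_le_one
    linarith
  exact
    { regression := hR
      τ_pos := by norm_num
      Mmin_pos := by positivity
      μmin_pos := h1
      M_measurable := hD.M_measurable
      M_indep := iIndepFun_rows (fun i j => hD.measurable_entry i j) hD.M_indep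
      M_ident := hD.identDistrib_row
      M_mean := fun i j => by rw [hD.integral_entry, hD.mean_eq]
      M_cov := hD.covariance_entry
      M_subGaussian := hD.isSubGaussianVector
      M_indep_w := hD.M_indep_w
      Mmin_le := fun j k => by
        have e : (1 - rmax) ^ 2 ≤ (1 - r j) * (1 - r k) := by
          rw [sq]
          exact mul_le_mul (by linarith [hr j]) (by linarith [hr k]) h1.le
            (by linarith [hr j])
        rw [hD.cov_eq, hD.mean_eq, hD.mean_eq]
        by_cases hjk : j = k
        · subst hjk
          rw [Matrix.diagonal_apply_eq]
          have : 0 ≤ r j * (1 - r j) := mul_nonneg (hr0 j) (by linarith [hr j])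
          exact e.trans (by linarith)
        · rw [Matrix.diagonal_apply_ne _ hjk, zero_add]
          exact e
      μmin_le := fun j => by rw [hD.mean_eq]; exact sub_le_sub_left (hr j) 1
      le_μmax := fun j => by rw [hD.mean_eq]; exact sub_le_self 1 (hr0 j) }

end MultData

end CoCoLasso

theorem mainTheorem7 :
    ∃ C c : ℝ, 0 < C ∧ 0 < c ∧
    ∃ ζ ε₀ : CoCoLasso.MultParams → ℝ → ℝ,
    ∃ ε₁ ε₂ ε₃ : CoCoLasso.MultParams → (B φ ψ Cmin γ : ℝ) → ℝ,
      (∀ θ B, 0 < ζ θ B) ∧ (∀ θ B, 0 < ε₀ θ B) ∧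
      (∀ θ B φ ψ Cmin γ, 0 < ε₁ θ B φ ψ Cmin γ ∧ 0 < ε₂ θ B φ ψ Cmin γ ∧
        0 < ε₃ θ B φ ψ Cmin γ) ∧
      -- finite-sample results
      (∀ (n p : ℕ) (Ω : Type*) [MeasurableSpace Ω] (P : MeasureTheory.Measure Ω)
        [MeasureTheory.IsProbabilityMeasure P] (θ : CoCoLasso.MultParams)
        (D : CoCoLasso.MultData n p Ω), D.IsMultModel P θ →
        -- `ζ` and `ε₀` are parameters of the closeness condition
        (∀ ε : ℝ, 0 < ε → ε ≤ ε₀ θ D.B →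
          (∀ j k, P.real {ω | ε ≤ |D.SigHat ω j k - D.Sig j k|}
            ≤ C * Real.exp (-(c * n * ε ^ 2 / ζ θ D.B))) ∧
          (∀ j, P.real {ω | ε ≤ |D.rhoTilde ω j - D.rho ω j|}
            ≤ C * Real.exp (-(c * n * ε ^ 2 / (D.s ^ 2 * ζ θ D.B))))) ∧
        -- `ℓ₂` and `ℓ₁` error bounds
        (0 < D.restrictedEigenvalue →
          ∀ lam ε : ℝ, 0 < lam → lam ≤ min (ε₀ θ D.B) (12 * ε₀ θ D.B * D.B) →
            0 < ε → ε ≤ min (ε₀ θ D.B) (D.restrictedEigenvalue / (64 * D.s)) →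
            P.real {ω | ¬ ∀ A, CoCoLasso.IsNearestPSD (D.SigHat ω) A →
                (∃ b, CoCoLasso.IsLassoMin A (D.rhoTilde ω) lam b) ∧
                ∀ b, CoCoLasso.IsLassoMin A (D.rhoTilde ω) lam b →
                  Real.sqrt (∑ j, (b j - D.β j) ^ 2)
                    ≤ C * lam * Real.sqrt D.s / D.restrictedEigenvalue ∧
                  ∑ j, |b j - D.β j| ≤ C * lam * D.s / D.restrictedEigenvalue}
              ≤ (p : ℝ) ^ 2 * C * Real.exp (-(c * n * lam ^ 2 / (D.s ^ 2 * ζ θ D.B)))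
                + (p : ℝ) ^ 2 * C * Real.exp (-(c * n * ε ^ 2 / ζ θ D.B))) ∧
        -- support recovery, `ℓ_∞` error bound, sign recovery
        (D.Irrepresentable →
          ∀ e₁ e₂ e₃ : ℝ,
            e₁ = ε₁ θ D.B (CoCoLasso.infNorm D.SigSS⁻¹) (CoCoLasso.infNorm D.SigSS) D.Cmin D.gam →
            e₂ = ε₂ θ D.B (CoCoLasso.infNorm D.SigSS⁻¹) (CoCoLasso.infNorm D.SigSS) D.Cmin D.gam →
            e₃ = ε₃ θ D.B (CoCoLasso.infNorm D.SigSS⁻¹) (CoCoLasso.infNorm D.SigSS) D.Cmin D.gam →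
          ∀ lam ε : ℝ, 0 < lam → lam ≤ min (ε₀ θ D.B) (4 * ε₀ θ D.B / D.gam) →
            0 < ε → ε ≤ min e₁ (lam / (lam * e₂ + e₃)) →
            P.real {ω | ¬ ∀ A, CoCoLasso.IsNearestPSD (D.SigHat ω) A →
                ∃ b, CoCoLasso.IsLassoMin A (D.rhoTilde ω) lam b ∧
                  (∀ b', CoCoLasso.IsLassoMin A (D.rhoTilde ω) lam b' → b' = b) ∧
                  (∀ j, j ∉ D.S → b j = 0) ∧
                  (∀ j ∈ D.S, |b j - D.β j| ≤ D.kap * lam) ∧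
                  (D.kap * lam ≤ D.betaMin →
                    ∀ j ∈ D.S, SignType.sign (b j) = SignType.sign (D.β j))}
              ≤ (p : ℝ) ^ 2 * C *
                  Real.exp (-(c * n * D.gam ^ 2 * lam ^ 2 / (D.s ^ 2 * ζ θ D.B)))
                + (p : ℝ) ^ 2 * C * Real.exp (-(c * n * ε ^ 2 / (D.s ^ 2 * ζ θ D.B))))) ∧
      -- asymptotic sign consistency
      (∀ (n p : ℕ → ℕ) (Ω : ℕ → Type*) [∀ k, MeasurableSpace (Ω k)]
        (P : ∀ k, MeasureTheory.Measure (Ω k)) [∀ k, MeasureTheory.IsProbabilityMeasure (P k)]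
        (θ : CoCoLasso.MultParams) (D : ∀ k, CoCoLasso.MultData (n k) (p k) (Ω k))
        (lam : ℕ → ℝ) (γ₀ κ₀ : ℝ),
        (∀ k, (D k).IsMultModel (P k) θ) →
        (∀ k, (D k).Irrepresentable) →
        0 < γ₀ → (∀ k, γ₀ ≤ (D k).gam) → (∀ k, (D k).kap ≤ κ₀) →
        Tendsto n atTop atTop → Tendsto p atTop atTop →
        Tendsto (fun k => (D k).s ^ 2 * Real.log (p k) / (n k)) atTop (𝓝 0) →
        (∀ k, 0 < lam k) →
        (fun k => (D k).s * Real.sqrt (ζ θ (D k).B * Real.log (p k) / (n k))) =o[atTop] lam →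
        lam =o[atTop] (fun k => (D k).betaMin) →
        Tendsto (fun k => (P k).real {ω | ¬ ∀ A, CoCoLasso.IsNearestPSD ((D k).SigHat ω) A →
            (∃ b, CoCoLasso.IsLassoMin A ((D k).rhoTilde ω) (lam k) b) ∧
            ∀ b, CoCoLasso.IsLassoMin A ((D k).rhoTilde ω) (lam k) b →
              ∀ j, SignType.sign (b j) = SignType.sign ((D k).β j)}) atTop (𝓝 0) ∧
        Tendsto (fun k => (P k).real {ω | ¬ ∀ A, CoCoLasso.IsNearestPSD ((D k).SigHat ω) A →
            (∃ b, CoCoLasso.IsLassoMin A ((D k).rhoTilde ω) (lam k) b) ∧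
            ∀ b, CoCoLasso.IsLassoMin A ((D k).rhoTilde ω) (lam k) b →
              ∀ j ∈ (D k).S, |b j - (D k).β j| ≤ (D k).kap * lam k}) atTop (𝓝 0)) ∧
      -- randomly missing data form a multiplicative error model with explicit constants
      (∀ (n p : ℕ) (Ω : Type*) [MeasurableSpace Ω] (P : MeasureTheory.Measure Ω)
        [MeasureTheory.IsProbabilityMeasure P] (D : CoCoLasso.MultData n p Ω)
        (σ Xmax rmax : ℝ) (r : Fin p → ℝ), D.IsRegression P σ Xmax → D.IsMissingData P r →
        rmax < 1 → (∀ j, r j ≤ rmax) →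
        D.IsMultModel P { τ := 1 / 2, σ := σ, Xmax := Xmax, Mmin := (1 - rmax) ^ 2,
                          μmin := 1 - rmax, μmax := 1 }) := by
  refine ⟨24, 1 / 73728, by norm_num, by norm_num, CoCoLasso.MultParams.rate, fun _ _ => 1,
    fun _ _ φ _ _ γ => 1 / (32 * |φ| / |γ| + 1), fun _ _ _ _ _ _ => 1,
    fun _ B _ _ _ γ => 16 * |B| / |γ| + 1, fun θ B => θ.rate_pos B, fun _ _ => one_pos,
    fun _ _ _ _ _ _ => ⟨by positivity, one_pos, by positivity⟩, ?_, ?_, ?_⟩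
  · intro n p Ω _ P _ θ D hM
    refine ⟨fun ε hε hε1 => ⟨hM.closeness_SigHat hε hε1, hM.closeness_rhoTilde hε hε1⟩, ?_, ?_⟩
    · intro hΩ lam ε hlam hlam1 hε hε1
      rw [le_min_iff] at hlam1 hε1
      beta_reduce at hlam1 hε1
      exact hM.error_bounds hΩ hlam hlam1.1 (by linarith [hlam1.2]) hε hε1.1 hε1.2
    · rintro hI _ _ _ rfl rfl rfl lam ε hlam hlam1 hε hε1
      rw [le_min_iff] at hlam1 hε1
      beta_reduce at hlam1 hε1
      have hγ := hI.1
      have hφ := CoCoLasso.infNorm_nonneg D.SigSS⁻¹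
      have hB := D.B_nonneg
      rw [abs_of_pos hγ, abs_of_nonneg hφ, abs_of_nonneg hB] at hε1
      obtain ⟨h1, h2⟩ := hε1
      obtain ⟨-, h3⟩ := hlam1
      rw [mul_one, le_div_iff₀ hγ] at h3
      have hφγ : 0 ≤ 32 * CoCoLasso.infNorm D.SigSS⁻¹ / D.gam := by positivity
      have hBγ : 0 ≤ 16 * D.B / D.gam := by positivity
      rw [le_div_iff₀ (by positivity)] at h1 h2
      refine hM.support_recovery hI hlam (by linarith) hε (by nlinarith) ?_ ?_
      · have h4 : 32 * CoCoLasso.infNorm D.SigSS⁻¹ / D.gam * ε ≤ 1 := by nlinarith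
        rw [div_mul_eq_mul_div, div_le_one hγ] at h4
        exact h4
      · have h4 : 16 * D.B / D.gam * ε ≤ lam := by nlinarith
        rw [div_mul_eq_mul_div, div_le_iff₀ hγ] at h4
        linarith
  · intro n p Ω _ P _ θ D lam γ₀ κ₀ hM hI hγ₀ hγ hκ hn hp hlog hlam hlarge hsmall
    exact ⟨CoCoLasso.MultData.tendsto_sign_consistency hM hI hγ₀ hγ hκ hn hp hlog hlam hlarge
        hsmall,
      CoCoLasso.MultData.tendsto_sup_norm_bound hM hI hγ₀ hγ hκ hn hp hlog hlam hlarge⟩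
  · intro n p Ω _ P _ D σ Xmax rmax r hR hD hrmax hr
    exact hD.isMultModel hR hrmax hr
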